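/- Let $\mathcal R=\overline{\bigotimes_{n\ge1}M_2(\mathbb C)}^{\,\mathrm{WOT}}$ be the hyperfinite $\mathrm{II}_1$ factor, acting by left multiplication on $L^2\big(\bigotimes_{n\ge1} M_2(\mathbb C),\tau\big)$, where $\tau$ is the product of the normalized traces. For $n\ge 1$ let $R_n=I^{\otimes(n-1)}\otimes R\in\mathcal R$ with $R=\begin{pmatrix}0&1\\1&0\end{pmatrix}$. For a set $S$ of operators let $W^*(S)$ denote the von Neumann algebra generated by $S$, and put $\mathcal A=W^*(\{R_n\}_{n\ge1})$, which is a Cartan masa of $\mathcal R$ (a maximal abelian von Neumann subalgebra whose normalizer $\{u\in\mathcal R \text{ unitary}: u\mathcal Au^*=\mathcal A\}$ generates $\mathcal R$). For $0<\alpha<1$ let $X_\alpha=\sum_{n\ge1}\alpha^nR_n$, a series that converges in operator norm. Then: 1. for every $0<\alpha<1$ the von Neumann algebra $W^*(X_\alpha)$ is abelian and diffuse, that is, it has no minimal projections; 2. if $0<\alpha\le\frac12$, then $W^*(X_\alpha)$ is the Cartan masa $\mathcal A$; 3. if $0<\alpha<1$ and $p(\alpha)=0$ for some polynomial $p(x)=a_1x^{n_1}+\dots+a_kx^{n_k}$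 with $k\ge1$, distinct exponents $n_i\ge 0$ and coefficients $a_i\in\{1,-1\}$, then $W^*(X_\alpha)\subsetneq\mathcal A$. For example, $\alpha=\frac{\sqrt5-1}{2}$ lies in $(0,1)$ and is a root of such a polynomial. -/

import Mathlib

open scoped ComplexConjugate

noncomputable section

namespace Hyperfinite

/-! ### Elementary tensors and the product trace -/

/-- The algebra `M₂(ℂ)`. -/
abbrev M2 : Type := Matrix (Fin 2) (Fin 2) ℂ

/-- An elementary tensor `⨂ₙ xₙ` with `xₙ ∈ M₂(ℂ)` and `xₙ = 1` for all but finitely many `n`.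
The tensor factors are indexed by `n = 0, 1, 2, …`. -/
@[ext]
structure ElemTensor where
  /-- The factor at site `n`. -/
  factor : ℕ → M2
  finite_ne_one : {n | factor n ≠ 1}.Finite

/-- The normalized trace on `M₂(ℂ)`. -/
def tr2 (u : M2) : ℂ := (1 / 2 : ℂ) * u.trace

/-- `τ(x* y) = ∏ₙ τₙ(xₙ* yₙ)`, for the product trace `τ` and elementary tensors `x`, `y`.
All but finitely many factors of this product are `1`. -/
def traceForm (x y : ElemTensor) : ℂ :=
  ∏ᶠ n, tr2 (star (x.factor n) * y.factor n)

/-- The elementary tensor `(1 ⊗ ⋯ ⊗ 1 ⊗ u ⊗ 1 ⊗ ⋯) x`, with `u` at site `n`. -/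
def ElemTensor.siteMul (n : ℕ) (u : M2) (x : ElemTensor) : ElemTensor where
  factor := Function.update x.factor n (u * x.factor n)
  finite_ne_one := by
    refine (x.finite_ne_one.insert n).subset fun m hm => ?_
    by_cases h : m = n
    · exact Or.inl h
    · right
      simpa [Function.update_of_ne h] using hm

lemma tr2_one : tr2 1 = 1 := by simp [tr2, Matrix.trace_one]

lemma traceForm_eq_prod (x y : ElemTensor) (s : Finset ℕ)
    (hx : {n | x.factor n ≠ 1} ⊆ s) (hy : {n | y.factor n ≠ 1} ⊆ s) :
    traceForm x y = ∏ n ∈ s, tr2 (star (x.factor n) * y.factor n) := by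
  refine finprod_eq_prod_of_mulSupport_subset _ fun n hn => ?_
  by_contra h
  have h1 : x.factor n = 1 := by
    by_contra h'; exact h (hx h')
  have h2 : y.factor n = 1 := by
    by_contra h'; exact h (hy h')
  exact hn (by simp [h1, h2, tr2_one])

lemma tr2_star (u v : M2) : conj (tr2 (star u * v)) = tr2 (star v * u) := by
  have h2 : conj (2 : ℂ) = 2 := Complex.conj_ofNat 2
  simp [tr2, Matrix.trace, Matrix.mul_apply, Fin.sum_univ_two, Matrix.star_apply, h2]
  ring

lemma traceForm_conj (x y : ElemTensor) : conj (traceForm x y) = traceForm y x := by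
  classical
  rw [traceForm_eq_prod x y (x.finite_ne_one.toFinset ∪ y.finite_ne_one.toFinset) (by simp)
      (by simp),
    traceForm_eq_prod y x (x.finite_ne_one.toFinset ∪ y.finite_ne_one.toFinset) (by simp)
      (by simp), map_prod]
  exact Finset.prod_congr rfl fun n _ => tr2_star _ _

lemma tr2_eq_sum (u v : M2) :
    tr2 (star u * v) =
      ∑ p : Fin 2 × Fin 2, (1 / 2 : ℂ) * (conj (u p.1 p.2) * v p.1 p.2) := by
  simp [tr2, Matrix.trace, Matrix.mul_apply, Fin.sum_univ_two, Matrix.star_apply,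
    Fintype.sum_prod_type]
  ring

/-! ### The form `τ(a* b)` on finite linear combinations of elementary tensors -/

/-- The form `τ(a* b)`, extended sesquilinearly from elementary tensors to their (formal) finite
linear combinations. -/
def form (a b : ElemTensor →₀ ℂ) : ℂ :=
  a.sum fun x r => b.sum fun y s => conj r * s * traceForm x y

lemma form_eq (a b : ElemTensor →₀ ℂ) (S : Finset ElemTensor)
    (ha : a.support ⊆ S) (hb : b.support ⊆ S) :
    form a b = ∑ x ∈ S, ∑ y ∈ S, conj (a x) * b y * traceForm x y := by
  unfold form
  rw [Finsupp.sum_of_support_subset a ha _ (by simp)]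
  refine Finset.sum_congr rfl fun x _ => ?_
  rw [Finsupp.sum_of_support_subset b hb _ (by simp)]

lemma form_self_nonneg (a : ElemTensor →₀ ℂ) : 0 ≤ (form a a).re := by
  classical
  set S := a.support with hS
  set s : Finset ℕ := S.biUnion fun x => x.finite_ne_one.toFinset with hs
  have hsub : ∀ x ∈ S, {n | x.factor n ≠ 1} ⊆ (s : Set ℕ) := by
    intro x hx n hn
    simp only [hs, Finset.coe_biUnion, Set.mem_iUnion]
    exact ⟨x, hx, by simpa using hn⟩
  have key : form a a = ∑ p : s → Fin 2 × Fin 2, ((1 / 2 : ℂ) ^ Fintype.card s) *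
      (conj (∑ x ∈ S, a x * ∏ n : s, x.factor n (p n).1 (p n).2) *
        ∑ x ∈ S, a x * ∏ n : s, x.factor n (p n).1 (p n).2) := by
    rw [form_eq a a S (le_of_eq hS.symm) (le_of_eq hS.symm)]
    have : ∀ x ∈ S, ∀ y ∈ S, traceForm x y = ∑ p : s → Fin 2 × Fin 2,
        ((1 / 2 : ℂ) ^ Fintype.card s) *
        (conj (∏ n : s, x.factor n (p n).1 (p n).2) *
          ∏ n : s, y.factor n (p n).1 (p n).2) := by
      intro x hx y hy
      rw [traceForm_eq_prod x y s (hsub x hx) (hsub y hy), ← Finset.prod_coe_sort]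
      simp_rw [tr2_eq_sum]
      rw [Finset.prod_univ_sum]
      simp only [Fintype.piFinset_univ]
      refine Finset.sum_congr rfl fun p _ => ?_
      rw [Finset.prod_mul_distrib, Finset.prod_mul_distrib, map_prod]
      simp
    rw [Finset.sum_congr rfl fun x hx => Finset.sum_congr rfl fun y hy => by rw [this x hx y hy]]
    simp_rw [map_sum, Finset.sum_mul, Finset.mul_sum]
    rw [Finset.sum_congr rfl fun x _ => Finset.sum_comm, Finset.sum_comm]
    refine Finset.sum_congr rfl fun p _ => ?_
    refine Finset.sum_congr rfl fun x _ => Finset.sum_congr rfl fun y _ => ?_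
    simp only [map_mul]
    ring
  rw [key, Complex.re_sum]
  refine Finset.sum_nonneg fun p _ => ?_
  rw [← Complex.normSq_eq_conj_mul_self]
  have : ((1 / 2 : ℂ) ^ Fintype.card s) = (((1 / 2 : ℝ) ^ Fintype.card s : ℝ) : ℂ) := by
    push_cast; rfl
  rw [this, ← Complex.ofReal_mul, Complex.ofReal_re]
  exact mul_nonneg (by positivity) (Complex.normSq_nonneg _)

lemma form_conj (a b : ElemTensor →₀ ℂ) : conj (form b a) = form a b := by
  classical
  rw [form_eq b a _ Finset.subset_union_right Finset.subset_union_left,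
    form_eq a b _ Finset.subset_union_left Finset.subset_union_right]
  simp only [map_sum, map_mul, Complex.conj_conj, traceForm_conj]
  rw [Finset.sum_comm]
  refine Finset.sum_congr rfl fun x _ => Finset.sum_congr rfl fun y _ => ?_
  ring

lemma form_add_left (a b c : ElemTensor →₀ ℂ) : form (a + b) c = form a c + form b c := by
  unfold form
  refine Finsupp.sum_add_index' (by simp) fun x r s => ?_
  simp [add_mul, Finsupp.sum_add]

lemma form_smul_left (a b : ElemTensor →₀ ℂ) (r : ℂ) : form (r • a) b = conj r * form a b := by
  unfold form
  refine (Finsupp.sum_smul_index (by simp)).trans ?_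
  simp [Finsupp.mul_sum, mul_assoc]

lemma form_mapDomain (n : ℕ) (u : M2) (a b : ElemTensor →₀ ℂ) :
    form (a.mapDomain (ElemTensor.siteMul n u)) (b.mapDomain (ElemTensor.siteMul n u)) =
      a.sum fun x r => b.sum fun y s =>
        conj r * s * traceForm (x.siteMul n u) (y.siteMul n u) := by
  unfold form
  rw [Finsupp.sum_mapDomain_index (by simp)]
  · refine Finsupp.sum_congr fun x _ => ?_
    rw [Finsupp.sum_mapDomain_index (by simp)]
    intros; ring
  · intro x r s
    simp only [map_add, add_mul, Finsupp.sum_add]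

lemma traceForm_siteMul (n : ℕ) (u : M2) (x y : ElemTensor) :
    traceForm (x.siteMul n u) (y.siteMul n u) +
      traceForm (x.siteMul n (star u.adjugate)) (y.siteMul n (star u.adjugate)) =
      (star u * u).trace * traceForm x y := by
  classical
  set s : Finset ℕ := insert n (x.finite_ne_one.toFinset ∪ y.finite_ne_one.toFinset) with hs
  have h1 : ∀ z : ElemTensor, {n | z.factor n ≠ 1} ⊆ (s : Set ℕ) →
      ∀ v : M2, {m | (z.siteMul n v).factor m ≠ 1} ⊆ (s : Set ℕ) := by
    intro z hz v m hm
    by_cases h : m = n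
    · simp [hs, h]
    · apply hz
      simpa [ElemTensor.siteMul, Function.update_of_ne h] using hm
  have hx : {n | x.factor n ≠ 1} ⊆ (s : Set ℕ) := by
    intro m hm; simp only [hs, Finset.coe_insert, Finset.coe_union, Set.Finite.coe_toFinset]
    exact Or.inr (Or.inl hm)
  have hy : {n | y.factor n ≠ 1} ⊆ (s : Set ℕ) := by
    intro m hm; simp only [hs, Finset.coe_insert, Finset.coe_union, Set.Finite.coe_toFinset]
    exact Or.inr (Or.inr hm)
  have hn : n ∈ s := by simp [hs]
  have hprod : ∀ v : M2, traceForm (x.siteMul n v) (y.siteMul n v) =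
      tr2 (star (v * x.factor n) * (v * y.factor n)) *
        ∏ m ∈ s.erase n, tr2 (star (x.factor m) * y.factor m) := by
    intro v
    rw [traceForm_eq_prod _ _ s (h1 x hx v) (h1 y hy v), ← Finset.mul_prod_erase s _ hn]
    congr 1
    · simp [ElemTensor.siteMul]
    · refine Finset.prod_congr rfl fun m hm => ?_
      simp [ElemTensor.siteMul, Function.update_of_ne (Finset.ne_of_mem_erase hm)]
  have hloc : ∀ a b : M2, tr2 (star (u * a) * (u * b)) +
      tr2 (star (star u.adjugate * a) * (star u.adjugate * b)) =
      (star u * u).trace * tr2 (star a * b) := by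
    intro a b
    simp [tr2, Matrix.trace, Matrix.mul_apply, Fin.sum_univ_two, Matrix.star_apply,
      Matrix.adjugate_fin_two]
    ring
  rw [hprod, hprod, traceForm_eq_prod x y s hx hy, ← Finset.mul_prod_erase s _ hn, ← add_mul,
    hloc, mul_assoc]

lemma trace_star_mul_self_nonneg (u : M2) : 0 ≤ ((star u * u).trace).re := by
  simp [Matrix.trace, Matrix.mul_apply, Fin.sum_univ_two, Matrix.star_apply]
  nlinarith [mul_self_nonneg (u 0 0).re, mul_self_nonneg (u 0 0).im,
    mul_self_nonneg (u 0 1).re, mul_self_nonneg (u 0 1).im,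
    mul_self_nonneg (u 1 0).re, mul_self_nonneg (u 1 0).im,
    mul_self_nonneg (u 1 1).re, mul_self_nonneg (u 1 1).im]

lemma form_mapDomain_le (n : ℕ) (u : M2) (a : ElemTensor →₀ ℂ) :
    (form (a.mapDomain (ElemTensor.siteMul n u)) (a.mapDomain (ElemTensor.siteMul n u))).re ≤
      (star u * u).trace.re * (form a a).re := by
  have h : form (a.mapDomain (ElemTensor.siteMul n u)) (a.mapDomain (ElemTensor.siteMul n u)) +
      form (a.mapDomain (ElemTensor.siteMul n (star u.adjugate)))
        (a.mapDomain (ElemTensor.siteMul n (star u.adjugate))) =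
      (star u * u).trace * form a a := by
    rw [form_mapDomain, form_mapDomain, form, ← Finsupp.sum_add, Finsupp.mul_sum]
    refine Finsupp.sum_congr fun x _ => ?_
    rw [← Finsupp.sum_add, Finsupp.mul_sum]
    refine Finsupp.sum_congr fun y _ => ?_
    rw [← mul_add, traceForm_siteMul]
    ring
  have him : ((star u * u).trace).im = 0 := by
    simp [Matrix.trace, Matrix.mul_apply, Fin.sum_univ_two, Matrix.star_apply]
    ring
  have h2 := congrArg Complex.re h
  rw [Complex.add_re, Complex.mul_re, him, zero_mul, sub_zero] at h2
  linarith [form_self_nonneg (a.mapDomain (ElemTensor.siteMul n (star u.adjugate)))]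

/-! ### The Hilbert space `L²(⨂ₙ M₂(ℂ), τ)` and left multiplication on it -/

/-- Formal finite linear combinations of elementary tensors, as a pre-Hilbert space with the
semi-inner product `⟨a, b⟩ = τ(a* b)`.  The relations that hold in the algebraic tensor product
`⨂ₙ M₂(ℂ)` (multilinearity of `(xₙ) ↦ ⨂ₙ xₙ`) hold here up to vectors of length `0`, that is,
they become equalities in the completion. -/
def PreL2 : Type := ElemTensor →₀ ℂ

instance : AddCommGroup PreL2 := inferInstanceAs (AddCommGroup (ElemTensor →₀ ℂ))
instance : Module ℂ PreL2 := inferInstanceAs (Module ℂ (ElemTensor →₀ ℂ))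

/-- The identification of `PreL2` with the formal finite linear combinations. -/
def PreL2.equiv : (ElemTensor →₀ ℂ) ≃ₗ[ℂ] PreL2 := LinearEquiv.refl ℂ _

/-- The semi-inner product `⟨a, b⟩ = τ(a* b)`. -/
abbrev PreL2.core : PreInnerProductSpace.Core ℂ PreL2 where
  inner a b := form (PreL2.equiv.symm a) (PreL2.equiv.symm b)
  conj_inner_symm _ _ := form_conj _ _
  re_inner_nonneg _ := form_self_nonneg _
  add_left _ _ _ := form_add_left _ _ _
  smul_left _ _ _ := form_smul_left _ _ _

instance : SeminormedAddCommGroup PreL2 :=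
  InnerProductSpace.Core.toSeminormedAddCommGroup (c := PreL2.core)
instance : InnerProductSpace ℂ PreL2 := InnerProductSpace.ofCore PreL2.core

/-- The Hilbert space `L²(⨂ₙ M₂(ℂ), τ)`. -/
abbrev L2 : Type := UniformSpace.Completion PreL2

/-- Left multiplication by `1 ⊗ ⋯ ⊗ 1 ⊗ u ⊗ 1 ⊗ ⋯`, with `u` at site `n`. -/
def siteMulLin (n : ℕ) (u : M2) : PreL2 →ₗ[ℂ] PreL2 :=
  PreL2.equiv.toLinearMap ∘ₗ Finsupp.lmapDomain ℂ ℂ (ElemTensor.siteMul n u) ∘ₗ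
    PreL2.equiv.symm.toLinearMap

lemma PreL2.inner_eq (a b : PreL2) :
    inner ℂ a b = form (PreL2.equiv.symm a) (PreL2.equiv.symm b) := rfl

lemma PreL2.norm_sq_eq (a : PreL2) :
    ‖a‖ ^ 2 = (form (PreL2.equiv.symm a) (PreL2.equiv.symm a)).re :=
  norm_sq_eq_re_inner (𝕜 := ℂ) a

lemma norm_siteMulLin_le (n : ℕ) (u : M2) (a : PreL2) :
    ‖siteMulLin n u a‖ ≤ √((star u * u).trace.re) * ‖a‖ := by
  refine abs_le_of_sq_le_sq' ?_ (by positivity) |>.2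
  rw [mul_pow, Real.sq_sqrt (trace_star_mul_self_nonneg u), PreL2.norm_sq_eq, PreL2.norm_sq_eq]
  exact form_mapDomain_le n u _

/-- The operator of left multiplication by `I^{⊗ n} ⊗ u` on `L²(⨂ₙ M₂(ℂ), τ)`. -/
def site (n : ℕ) (u : M2) : L2 →L[ℂ] L2 :=
  ((siteMulLin n u).mkContinuous (√((star u * u).trace.re)) (norm_siteMulLin_le n u)).completion

end Hyperfinite

/-! ### Von Neumann algebras of operators -/

section VonNeumann

variable {H : Type*} [NormedAddCommGroup H] [InnerProductSpace ℂ H] [CompleteSpace H]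

/-- The von Neumann algebra `W*(S)` generated by a set `S` of operators: the bicommutant of
`S ∪ S*`. -/
def VonNeumannAlgebra.generatedBy (S : Set (H →L[ℂ] H)) : VonNeumannAlgebra H where
  toStarSubalgebra := StarSubalgebra.centralizer ℂ (StarSubalgebra.centralizer ℂ S : Set _)
  centralizer_centralizer' := by
    simp

/-- A von Neumann algebra is abelian if its elements commute. -/
def VonNeumannAlgebra.IsAbelian (N : VonNeumannAlgebra H) : Prop :=
  ∀ a ∈ N, ∀ b ∈ N, a * b = b * a

/-- A von Neumann algebra is diffuse if it has no minimal projection: below every nonzero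
projection there is a projection strictly between `0` and it. -/
def VonNeumannAlgebra.IsDiffuse (N : VonNeumannAlgebra H) : Prop :=
  ∀ p ∈ N, IsStarProjection p → p ≠ 0 →
    ∃ q ∈ N, IsStarProjection q ∧ p * q = q ∧ q ≠ 0 ∧ q ≠ p

/-- `A` is a maximal abelian von Neumann subalgebra (masa) of `M`. -/
def VonNeumannAlgebra.IsMasa (A M : VonNeumannAlgebra H) : Prop :=
  A ≤ M ∧ A.IsAbelian ∧ ∀ B : VonNeumannAlgebra H, B ≤ M → B.IsAbelian → A ≤ B → B = A

/-- The unitaries `u` of `M` such that `u A u* = A`. -/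
def VonNeumannAlgebra.normalizer (A M : VonNeumannAlgebra H) : Set (H →L[ℂ] H) :=
  {u | u ∈ M ∧ u ∈ unitary (H →L[ℂ] H) ∧ (fun a => u * a * star u) '' (A : Set _) = A}

/-- `A` is a Cartan masa of the (finite) von Neumann algebra `M`: a masa whose normalizer
generates `M`. -/
def VonNeumannAlgebra.IsCartanMasa (A M : VonNeumannAlgebra H) : Prop :=
  A.IsMasa M ∧ VonNeumannAlgebra.generatedBy (A.normalizer M) = M

end VonNeumann

namespace Hyperfinite

/-- The hyperfinite `II₁` factor `𝓡`: the von Neumann algebra on `L²(⨂ₙ M₂(ℂ), τ)` generated by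
left multiplications. -/
def R : VonNeumannAlgebra L2 :=
  VonNeumannAlgebra.generatedBy {T | ∃ n u, T = site n u}

/-- `Rₙ = I^{⊗ (n-1)} ⊗ R` with `R = (0 1; 1 0)`, for `n = 1, 2, 3, …`: the `n`-th tensor factor
is at site `n - 1`. -/
def Rop (n : ℕ+) : L2 →L[ℂ] L2 := site ((n : ℕ) - 1) !![0, 1; 1, 0]

/-- `𝓐 = W*({Rₙ})`. -/
def cartanMasa : VonNeumannAlgebra L2 := VonNeumannAlgebra.generatedBy (Set.range Rop)

/-- `X_α = ∑_{n ≥ 1} αⁿ Rₙ`, a series in the operator norm. -/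
def X (α : ℝ) : L2 →L[ℂ] L2 := ∑' n : ℕ+, ((α : ℂ) ^ (n : ℕ)) • Rop n

/-- `W*(X_α)`. -/
def WX (α : ℝ) : VonNeumannAlgebra L2 := VonNeumannAlgebra.generatedBy {X α}

/-- `α` is a root of `a₁ x^{n₁} + ⋯ + a_k x^{n_k}` for some `k ≥ 1`, some distinct exponents
`nᵢ ≥ 0` and some signs `aᵢ ∈ {1, -1}`. -/
def IsSignedPolynomialRoot (α : ℝ) : Prop :=
  ∃ p : Polynomial ℤ, p ≠ 0 ∧ (∀ i ∈ p.support, p.coeff i = 1 ∨ p.coeff i = -1) ∧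
    Polynomial.aeval α p = 0

end Hyperfinite

end

/-!
Write `R` and `D` for the symmetries `reflM` and `flipM` of `M₂(ℂ)`, which anticommute, and `refl n`,
`flip n` for the left multiplications by them at site `n`. The operators `X α` are series
`∑ₙ cₙ Rₙ` with `Rₙ = refl n`, and everything about them comes from moving the sign of a single
`Rₙ` by conjugation with `flip n`.

*No eigenvectors* (`eq_zero_of_series_apply_eq_smul`). The operator `conjFlip n`, which is
conjugation by `D` at site `n`, satisfies `C X = (X - 2 cₙ Rₙ) C`. It therefore maps an eigenvector
`ξ` of `X` to a vector orthogonal to `ξ` whenever `cₙ ≠ 0`, while `conjFlip n ξ → ξ`. An abelian von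
Neumann algebra that contains a self-adjoint operator without eigenvectors is diffuse
(`isDiffuse_of_forall_eigenvector_eq_zero`).

*The case `α ≤ 1 / 2`*. Then `αᵐ⁺¹` dominates the sum of the later coefficients, so the tail
`Y = ∑_{n ≥ m} αⁿ⁺¹ Rₙ` satisfies `Y Rₘ ≥ 0`, that is, `|Y| = Y Rₘ`. Since `Y` is injective, an
operator that commutes with `Y` commutes with `Rₘ` (`commute_refl_of_commute_series`), and the
`Rₘ` are recovered from `X α` one after the other (`WX_eq_cartanMasa`).

*Signed polynomials* (`WX_lt_cartanMasa`). If `∑_{n ∈ E} sₙ αⁿ = 0` with signs `sₙ`, the product `Q`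
of the `1 + sₙ Rₙ` is a joint eigenoperator, and with the product `D` of the `flip n` over `E` the
operator `D Q` commutes with `X α` but not with the `Rₙ`, `n ∈ E`.

*The Cartan masa*. In the orthonormal basis of Pauli strings (`pauliBasis`), indexed by pairs
`(F, G)` of finite sets of sites, an element of `𝓡` that commutes with `𝓐` is a convolution in `F`
that ignores `G`, since it commutes with all right multiplications. An operator in the commutant
of `𝓐` has blocks that are convolutions in `F`. Convolutions commute, so the bicommutant `𝓐`
contains the former (`mem_cartanMasa_of_commute`). The `refl n` and `flip n` normalize `𝓐` and
generate `𝓡`.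
-/

namespace Hyperfinite

/-! ### Elementary tensors as vectors of `L2` -/

/-- The elementary tensor `x`, as a vector of `L²(⨂ₙ M₂(ℂ), τ)`. -/
noncomputable def elem (x : ElemTensor) : L2 :=
  ((PreL2.equiv (Finsupp.single x 1) : PreL2) : L2)

lemma inner_elem (x y : ElemTensor) : inner ℂ (elem x) (elem y) = traceForm x y := by
  rw [elem, elem, UniformSpace.Completion.inner_coe, PreL2.inner_eq]
  simp [form]

lemma dense_span_elem : Dense (Submodule.span ℂ (Set.range elem) : Set L2) := by
  have key : ∀ a : ElemTensor →₀ ℂ,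
      ((PreL2.equiv a : PreL2) : L2) ∈ Submodule.span ℂ (Set.range elem) := by
    intro a
    induction a using Finsupp.induction_linear with
    | zero => rw [map_zero, UniformSpace.Completion.coe_zero]; exact zero_mem _
    | add f g hf hg =>
      rw [map_add, UniformSpace.Completion.coe_add]
      exact add_mem hf hg
    | single x c =>
      rw [← mul_one c, ← smul_eq_mul, ← Finsupp.smul_single, map_smul,
        UniformSpace.Completion.coe_smul]
      exact Submodule.smul_mem _ _ (Submodule.subset_span ⟨x, rfl⟩)
  refine UniformSpace.Completion.denseRange_coe.mono ?_
  rintro _ ⟨a, rfl⟩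
  exact key (PreL2.equiv.symm a)

lemma ext_elem {T S : L2 →L[ℂ] L2} (h : ∀ x, T (elem x) = S (elem x)) : T = S :=
  ContinuousLinearMap.ext_on dense_span_elem (by rintro _ ⟨x, rfl⟩; exact h x)

lemma ext_inner_elem {v w : L2} (h : ∀ x, inner ℂ (elem x) v = inner ℂ (elem x) w) : v = w := by
  have : innerSL ℂ v = innerSL ℂ w := by
    refine ContinuousLinearMap.ext_on dense_span_elem ?_
    rintro _ ⟨x, rfl⟩
    simp only [innerSL_apply_apply]
    rw [← inner_conj_symm, h, inner_conj_symm]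
  exact ext_inner_right ℂ fun z => by simpa using congrArg (fun f => f z) this

lemma ext_inner_inner_elem {T S : L2 →L[ℂ] L2}
    (h : ∀ x y, inner ℂ (elem x) (T (elem y)) = inner ℂ (elem x) (S (elem y))) : T = S :=
  ext_elem fun y => ext_inner_elem fun x => h x y

lemma site_elem (n : ℕ) (u : M2) (x : ElemTensor) : site n u (elem x) = elem (x.siteMul n u) := by
  rw [site, elem, ContinuousLinearMap.completion_apply_coe]
  simp [siteMulLin, elem, Finsupp.mapDomain_single]

/-! ### The algebra of the operators `site n u` -/

lemma mulSupport_traceForm_finite (x y : ElemTensor) :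
    (Function.mulSupport fun n => tr2 (star (x.factor n) * y.factor n)).Finite := by
  refine (x.finite_ne_one.union y.finite_ne_one).subset fun n hn => ?_
  by_contra h
  simp only [Set.mem_union, Set.mem_ofPred_eq, not_or, not_not] at h
  exact hn (by simp [h.1, h.2, tr2_one])

/-- The factor at site `n` splits off the product that defines `traceForm`. -/
lemma traceForm_eq_mul (n : ℕ) (x y : ElemTensor) :
    traceForm x y = tr2 (star (x.factor n) * y.factor n) *
      ∏ᶠ (m : ℕ) (_ : m ≠ n), tr2 (star (x.factor m) * y.factor m) :=
  (mul_finprod_cond_ne n (mulSupport_traceForm_finite x y)).symm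

lemma factor_siteMul_self (n : ℕ) (u : M2) (x : ElemTensor) :
    (x.siteMul n u).factor n = u * x.factor n := by simp [ElemTensor.siteMul]

lemma factor_siteMul_ne {n m : ℕ} (h : m ≠ n) (u : M2) (x : ElemTensor) :
    (x.siteMul n u).factor m = x.factor m := by
  simp [ElemTensor.siteMul, Function.update_of_ne h]

lemma traceForm_siteMul_right (n : ℕ) (u : M2) (x y : ElemTensor) :
    traceForm x (y.siteMul n u) = tr2 (star (x.factor n) * (u * y.factor n)) *
      ∏ᶠ (m : ℕ) (_ : m ≠ n), tr2 (star (x.factor m) * y.factor m) := by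
  rw [traceForm_eq_mul n, factor_siteMul_self]
  congr 1
  exact finprod_congr fun m => finprod_congr fun h => by rw [factor_siteMul_ne h]

lemma traceForm_siteMul_left (n : ℕ) (u : M2) (x y : ElemTensor) :
    traceForm (x.siteMul n u) y = traceForm x (y.siteMul n (star u)) := by
  rw [traceForm_siteMul_right, traceForm_eq_mul n, factor_siteMul_self, star_mul, mul_assoc]
  congr 1
  exact finprod_congr fun m => finprod_congr fun h => by rw [factor_siteMul_ne h]

lemma site_add (n : ℕ) (u v : M2) : site n (u + v) = site n u + site n v := by
  refine ext_inner_inner_elem fun x y => ?_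
  simp only [add_apply, inner_add_right, site_elem, inner_elem, traceForm_siteMul_right]
  simp [tr2, mul_add, add_mul]

lemma site_smul (n : ℕ) (c : ℂ) (u : M2) : site n (c • u) = c • site n u := by
  refine ext_inner_inner_elem fun x y => ?_
  simp only [smul_apply, inner_smul_right, site_elem, inner_elem, traceForm_siteMul_right]
  simp [tr2]
  ring

lemma site_one (n : ℕ) : site n 1 = 1 := by
  refine ext_elem fun x => ?_
  rw [site_elem]
  change _ = elem x
  congr 1
  ext m : 2
  simp [ElemTensor.siteMul]

lemma site_mul (n : ℕ) (u v : M2) : site n u * site n v = site n (u * v) := by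
  refine ext_elem fun x => ?_
  rw [mul_apply_eq_comp, site_elem, site_elem, site_elem]
  congr 1
  ext m : 2
  simp [ElemTensor.siteMul, mul_assoc]

lemma site_neg (n : ℕ) (u : M2) : site n (-u) = -site n u := by
  rw [← neg_one_smul ℂ u, site_smul, neg_one_smul]

lemma star_site (n : ℕ) (u : M2) : star (site n u) = site n (star u) := by
  refine ext_inner_inner_elem fun x y => ?_
  rw [ContinuousLinearMap.star_eq_adjoint, ContinuousLinearMap.adjoint_inner_right, site_elem,
    site_elem, inner_elem, inner_elem, traceForm_siteMul_left]

lemma commute_site_of_ne {n m : ℕ} (h : n ≠ m) (u v : M2) : Commute (site n u) (site m v) := by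
  refine ext_elem fun x => ?_
  simp only [mul_apply_eq_comp, site_elem]
  congr 1
  ext k : 2
  simp only [ElemTensor.siteMul, Function.update_of_ne h, Function.update_of_ne h.symm]
  rw [Function.update_comm h.symm]

/-! ### Operators permuting the elementary tensors -/

/-- The isometry of `L2` that sends every elementary tensor `x` to `φ x`, for a map `φ` that
preserves the inner products of elementary tensors. -/
noncomputable def isoOp (φ : ElemTensor → ElemTensor)
    (hφ : ∀ x y, traceForm (φ x) (φ y) = traceForm x y) : L2 →L[ℂ] L2 :=
  ((PreL2.equiv.toLinearMap ∘ₗ Finsupp.lmapDomain ℂ ℂ φ ∘ₗ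
    PreL2.equiv.symm.toLinearMap).mkContinuous 1 (by
      intro a
      rw [one_mul]
      refine abs_le_of_sq_le_sq' (le_of_eq ?_) (norm_nonneg _) |>.2
      rw [PreL2.norm_sq_eq, PreL2.norm_sq_eq]
      congr 1
      change form (Finsupp.mapDomain φ (PreL2.equiv.symm a))
        (Finsupp.mapDomain φ (PreL2.equiv.symm a)) = _
      unfold form
      rw [Finsupp.sum_mapDomain_index (by simp)]
      · refine Finsupp.sum_congr fun x _ => ?_
        rw [Finsupp.sum_mapDomain_index (by simp)]
        · simp only [hφ]
        · intros; ring
      · intro x r s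
        simp only [map_add, add_mul, Finsupp.sum_add])).completion

lemma isoOp_elem (φ : ElemTensor → ElemTensor)
    (hφ : ∀ x y, traceForm (φ x) (φ y) = traceForm x y) (x : ElemTensor) :
    isoOp φ hφ (elem x) = elem (φ x) := by
  rw [isoOp, elem, ContinuousLinearMap.completion_apply_coe]
  simp [elem, Finsupp.mapDomain_single]

/-- The elementary tensor `x (1 ⊗ ⋯ ⊗ 1 ⊗ v ⊗ 1 ⊗ ⋯)`, with `v` at site `n`. -/
def ElemTensor.mulSite (n : ℕ) (v : M2) (x : ElemTensor) : ElemTensor where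
  factor := Function.update x.factor n (x.factor n * v)
  finite_ne_one := by
    refine (x.finite_ne_one.insert n).subset fun m hm => ?_
    by_cases h : m = n
    · exact Or.inl h
    · right
      simpa [Function.update_of_ne h] using hm

lemma traceForm_mulSite (n : ℕ) {v : M2} (hv : v * star v = 1) (x y : ElemTensor) :
    traceForm (x.mulSite n v) (y.mulSite n v) = traceForm x y := by
  rw [traceForm_eq_mul n, traceForm_eq_mul n x]
  congr 1
  · simp only [ElemTensor.mulSite, Function.update_self, star_mul, tr2]
    rw [mul_assoc, Matrix.trace_mul_comm, mul_assoc, mul_assoc, hv, mul_one]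
  · refine finprod_congr fun m => finprod_congr fun h => ?_
    simp [ElemTensor.mulSite, Function.update_of_ne h]

/-- The operator of right multiplication by the unitary `I^{⊗ n} ⊗ v`. It belongs to the commutant
of the hyperfinite factor. -/
noncomputable def rightSite (n : ℕ) (v : M2) (hv : v * star v = 1) : L2 →L[ℂ] L2 :=
  isoOp (ElemTensor.mulSite n v) (traceForm_mulSite n hv)

lemma rightSite_elem (n : ℕ) (v : M2) (hv : v * star v = 1) (x : ElemTensor) :
    rightSite n v hv (elem x) = elem (x.mulSite n v) := isoOp_elem _ _ _

lemma commute_site_rightSite (n m : ℕ) (u v : M2) (hv : v * star v = 1) :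
    Commute (site n u) (rightSite m v hv) := by
  refine ext_elem fun x => ?_
  simp only [mul_apply_eq_comp, site_elem, rightSite_elem]
  congr 1
  ext k : 2
  rcases eq_or_ne n m with rfl | h
  · simp [ElemTensor.siteMul, ElemTensor.mulSite, mul_assoc]
  · simp only [ElemTensor.siteMul, ElemTensor.mulSite, Function.update_of_ne h,
      Function.update_of_ne h.symm]
    rw [Function.update_comm h]

/-! ### Reflections and flips -/

/-- The matrix `R`, with spectrum `{1, -1}`. -/
abbrev reflM : M2 := !![0, 1; 1, 0]

/-- A diagonal symmetry that anticommutes with `reflM`. -/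
abbrev flipM : M2 := !![1, 0; 0, -1]

lemma reflM_mul_self : reflM * reflM = 1 := by
  simp [Matrix.one_fin_two]

lemma flipM_mul_self : flipM * flipM = 1 := by
  simp [Matrix.one_fin_two]

lemma flipM_mul_reflM : flipM * reflM = -(reflM * flipM) := by
  simp

lemma star_reflM : star reflM = reflM := by
  ext i j; fin_cases i <;> fin_cases j <;> simp [Matrix.star_apply]

lemma star_flipM : star flipM = flipM := by
  ext i j; fin_cases i <;> fin_cases j <;> simp [Matrix.star_apply]

/-- Left multiplication by `R` at site `n`. -/
noncomputable def refl (n : ℕ) : L2 →L[ℂ] L2 := site n reflM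

/-- Left multiplication by `flipM` at site `n`; conjugation by it changes the sign of `refl n`. -/
noncomputable def flip (n : ℕ) : L2 →L[ℂ] L2 := site n flipM

lemma refl_mul_self (n : ℕ) : refl n * refl n = 1 := by
  rw [refl, site_mul, reflM_mul_self, site_one]

lemma flip_mul_self (n : ℕ) : flip n * flip n = 1 := by
  rw [flip, site_mul, flipM_mul_self, site_one]

lemma flip_mul_refl (n : ℕ) : flip n * refl n = -(refl n * flip n) := by
  rw [flip, refl, site_mul, site_mul, flipM_mul_reflM, site_neg]

lemma isSelfAdjoint_refl (n : ℕ) : IsSelfAdjoint (refl n) := by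
  rw [IsSelfAdjoint, refl, star_site, star_reflM]

lemma isSelfAdjoint_flip (n : ℕ) : IsSelfAdjoint (flip n) := by
  rw [IsSelfAdjoint, flip, star_site, star_flipM]

lemma commute_refl (n m : ℕ) : Commute (refl n) (refl m) := by
  rcases eq_or_ne n m with rfl | h
  · exact Commute.refl _
  · exact commute_site_of_ne h _ _

lemma commute_flip_refl {n m : ℕ} (h : n ≠ m) : Commute (flip n) (refl m) :=
  commute_site_of_ne h _ _

lemma norm_refl_le (n : ℕ) : ‖refl n‖ ≤ 1 := by
  have h := CStarRing.norm_star_mul_self (x := refl n)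
  rw [(isSelfAdjoint_refl n).star_eq, refl_mul_self] at h
  have h1 : ‖(1 : L2 →L[ℂ] L2)‖ ≤ 1 := ContinuousLinearMap.norm_id_le
  nlinarith [norm_nonneg (refl n)]

/-- Every `2 × 2` matrix is a combination of `1`, `R`, `D` and `R D`, where `D` is `flipM`. -/
lemma M2_eq (u : M2) : u = ((u 0 0 + u 1 1) / 2) • 1 + ((u 0 1 + u 1 0) / 2) • reflM +
    ((u 0 0 - u 1 1) / 2) • flipM + ((u 1 0 - u 0 1) / 2) • (reflM * flipM) := by
  ext i j
  fin_cases i <;> fin_cases j <;> simp <;> ring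

lemma site_eq (n : ℕ) (u : M2) : site n u = ((u 0 0 + u 1 1) / 2) • 1 +
    ((u 0 1 + u 1 0) / 2) • refl n + ((u 0 0 - u 1 1) / 2) • flip n +
    ((u 1 0 - u 0 1) / 2) • (refl n * flip n) := by
  conv_lhs => rw [M2_eq u]
  simp only [site_add, site_smul, site_one, ← site_mul]
  rfl

end Hyperfinite

/-! ### Generated von Neumann algebras and diffuseness -/

namespace VonNeumannAlgebra

variable {H : Type*} [NormedAddCommGroup H] [InnerProductSpace ℂ H] [CompleteSpace H]

lemma mem_generatedBy {S : Set (H →L[ℂ] H)} {T : H →L[ℂ] H} : T ∈ generatedBy S ↔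
    ∀ y, (∀ s ∈ S, Commute s y ∧ Commute (star s) y) → Commute y T := by
  change T ∈ StarSubalgebra.centralizer ℂ (StarSubalgebra.centralizer ℂ S : Set _) ↔ _
  rw [StarSubalgebra.mem_centralizer_iff]
  constructor
  · intro h y hy
    exact (h y (StarSubalgebra.mem_centralizer_iff ℂ |>.2 hy)).1
  · intro h y hy
    exact ⟨h y (StarSubalgebra.mem_centralizer_iff ℂ |>.1 hy),
      h _ (StarSubalgebra.mem_centralizer_iff ℂ |>.1 (star_mem hy))⟩

lemma mem_generatedBy_of_isSelfAdjoint {S : Set (H →L[ℂ] H)} (hS : ∀ s ∈ S, IsSelfAdjoint s)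
    {T : H →L[ℂ] H} : T ∈ generatedBy S ↔ ∀ y, (∀ s ∈ S, Commute s y) → Commute y T := by
  rw [mem_generatedBy]
  refine forall_congr' fun y => imp_congr_left <| forall₂_congr fun s hs => ?_
  rw [(hS s hs).star_eq, and_self_iff]

lemma subset_generatedBy (S : Set (H →L[ℂ] H)) {T : H →L[ℂ] H} (hT : T ∈ S) :
    T ∈ generatedBy S :=
  mem_generatedBy.2 fun _ hy => (hy T hT).1.symm

lemma generatedBy_le {S : Set (H →L[ℂ] H)} {N : VonNeumannAlgebra H} (h : ∀ T ∈ S, T ∈ N) :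
    generatedBy S ≤ N := by
  intro T hT
  rw [← N.commutant_commutant, mem_commutant_iff]
  intro y hy
  refine mem_generatedBy.1 hT y fun s hs => ?_
  rw [mem_commutant_iff] at hy
  exact ⟨hy s (h s hs), hy _ (star_mem (h s hs))⟩

lemma isAbelian_generatedBy {S : Set (H →L[ℂ] H)} (hS : ∀ s ∈ S, IsSelfAdjoint s)
    (hc : ∀ s ∈ S, ∀ t ∈ S, Commute s t) : (generatedBy S).IsAbelian := by
  intro a ha b hb
  refine (mem_generatedBy_of_isSelfAdjoint hS).1 hb a fun s hs => ?_
  exact (mem_generatedBy_of_isSelfAdjoint hS).1 ha s fun t ht => hc t ht s hs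

/-- An abelian von Neumann algebra is diffuse if it contains a self-adjoint operator without
eigenvectors. For a projection `p`, a vector `ξ = p ξ ≠ 0` and `t = ⟨ξ, X ξ⟩ / ‖ξ‖²`, the operator
`Y = (X - t) p` is neither positive nor negative, since otherwise `⟨ξ, Y ξ⟩ = 0` would give
`Y ξ = 0`; so the range projection of its positive part lies strictly between `0` and `p`. -/
lemma isDiffuse_of_forall_eigenvector_eq_zero {N : VonNeumannAlgebra H} (hN : N.IsAbelian)
    {X : H →L[ℂ] H} (hX : X ∈ N) (hXs : IsSelfAdjoint X)
    (hev : ∀ (t : ℝ) (ξ : H), X ξ = (t : ℂ) • ξ → ξ = 0) : N.IsDiffuse := by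
  intro p hp hproj hp0
  obtain ⟨ξ₀, hξ₀⟩ : ∃ ξ, p ξ ≠ 0 := by
    by_contra! h
    exact hp0 (ContinuousLinearMap.ext h)
  set ξ := p ξ₀ with hξ
  have hpp : p * p = p := hproj.isIdempotentElem
  have hps : star p = p := hproj.isSelfAdjoint
  have hpξ : p ξ = ξ := congrArg (fun T => T ξ₀) hpp
  set t : ℝ := (inner ℂ ξ (X ξ) : ℂ).re / ‖ξ‖ ^ 2 with ht
  have hξn : ‖ξ‖ ^ 2 ≠ 0 := by simpa using hξ₀
  set Y : H →L[ℂ] H := X * p - (t : ℂ) • p with hY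
  have hcXp : X * p = p * X := hN X hX p hp
  have hYN : Y ∈ N :=
    sub_mem (mul_mem hX hp) (N.toStarSubalgebra.smul_mem (show p ∈ N.toStarSubalgebra from hp) _)
  have hYs : IsSelfAdjoint Y := by
    rw [IsSelfAdjoint, hY, star_sub, star_mul, star_smul, hps, hXs.star_eq, hcXp]
    simp
  have hYp : Y * p = Y := by
    rw [hY, sub_mul, mul_assoc, hpp, smul_mul_assoc, hpp]
  have hpY : p * Y = Y := by
    rw [hY, mul_sub, ← mul_assoc, ← hcXp, mul_assoc, hpp, mul_smul_comm, hpp]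
  have hYξ : Y ξ = X ξ - (t : ℂ) • ξ := by
    change X (p ξ) - (t : ℂ) • p ξ = _
    rw [hpξ]
  have hYξ0 : Y ξ ≠ 0 := fun h => hξ₀ (hev t ξ (sub_eq_zero.1 (hYξ ▸ h)))
  have hre : (inner ℂ ξ (Y ξ) : ℂ).re = 0 := by
    rw [hYξ, inner_sub_right, inner_smul_right, inner_self_eq_norm_sq_to_K, Complex.sub_re,
      Complex.re_ofReal_mul, ht]
    have : ((((‖ξ‖ : ℝ) : ℂ)) ^ 2).re = ‖ξ‖ ^ 2 := by rw [← Complex.ofReal_pow, Complex.ofReal_re]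
    erw [this]
    field_simp
    simp
  -- A positive operator whose form vanishes at `ξ` vanishes at `ξ`.
  have hpos : ∀ a : H →L[ℂ] H, 0 ≤ a → (inner ℂ ξ (a ξ) : ℂ).re = 0 → a ξ = 0 := by
    intro a ha h0
    have hs : IsSelfAdjoint (CFC.sqrt a) := (CFC.sqrt_nonneg a).isSelfAdjoint
    have hsq : CFC.sqrt a * CFC.sqrt a = a := CFC.sqrt_mul_sqrt_self a ha
    have hz : CFC.sqrt a ξ = 0 := by
      rw [← hsq, mul_apply_eq_comp, ← ContinuousLinearMap.adjoint_inner_left,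
        ← ContinuousLinearMap.star_eq_adjoint, hs.star_eq] at h0
      rw [← norm_eq_zero, ← sq_eq_zero_iff, ← h0]
      exact norm_sq_eq_re_inner (𝕜 := ℂ) _
    rw [← hsq, mul_apply_eq_comp, hz, map_zero]
  set f := Y⁺ with hf
  set g := Y⁻ with hg
  have hfg : Y = f - g := (CFC.posPart_sub_negPart Y hYs).symm
  have hf0 : f ≠ 0 := by
    intro h
    apply hYξ0
    have h1 : g ξ = 0 := by
      refine hpos g (CFC.negPart_nonneg Y) ?_
      rw [hfg, h, zero_sub] at hre
      simpa using hre
    rw [hfg, h, zero_sub, neg_apply, h1, neg_zero]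
  have hg0 : g ≠ 0 := by
    intro h
    apply hYξ0
    rw [hfg, h, sub_zero]
    refine hpos f (CFC.posPart_nonneg Y) ?_
    rwa [hfg, h, sub_zero] at hre
  have hfs : star f = f := (CFC.posPart_nonneg Y).isSelfAdjoint
  have hgs : star g = g := (CFC.negPart_nonneg Y).isSelfAdjoint
  have hgf : g * f = 0 := CFC.negPart_mul_posPart Y
  have hfg0 : f * g = 0 := CFC.posPart_mul_negPart Y
  have hcommf : ∀ y, Commute Y y → Commute f y := fun y h => h.cfcₙ_real _
  have hcommg : ∀ y, Commute Y y → Commute g y := fun y h => h.cfcₙ_real _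
  have hfp : f * (1 - p) = 0 := by
    have h1 : f * (f * (1 - p)) = 0 := by
      have : f * (Y * (1 - p)) = 0 := by rw [mul_sub, hYp, mul_one, sub_self, mul_zero]
      rwa [hfg, sub_mul, mul_sub, ← mul_assoc f g, hfg0, zero_mul, sub_zero] at this
    rw [← CStarRing.star_mul_self_eq_zero_iff, star_mul, hfs, mul_assoc, h1, mul_zero]
  have hgp : g * p = g := by
    have h1 : g * (1 - p) = 0 := by
      have : Y * (1 - p) = 0 := by rw [mul_sub, hYp, mul_one, sub_self]
      rwa [hfg, sub_mul, hfp, zero_sub, neg_eq_zero] at this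
    rwa [mul_sub, mul_one, sub_eq_zero, eq_comm] at h1
  have hpf : p * f = f := by
    rw [← (hcommf p (show Y * p = p * Y by rw [hYp, hpY])).eq]
    rwa [mul_sub, mul_one, sub_eq_zero, eq_comm] at hfp
  set K := f.range.topologicalClosure with hK
  have : CompleteSpace K := (f.range.isClosed_topologicalClosure).completeSpace_coe
  have hle : ∀ (a : H →L[ℂ] H), a * f = 0 → a * K.starProjection = 0 := by
    intro a ha
    ext v
    have hsub : K ≤ a.ker := by
      refine Submodule.topologicalClosure_minimal _ ?_ a.isClosed_ker
      rintro _ ⟨w, rfl⟩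
      exact congrArg (fun T => T w) ha
    exact hsub (K.starProjection_apply_mem v)
  have hqf : K.starProjection * f = f := by
    ext v
    exact Submodule.starProjection_eq_self_iff.2 (f.range.le_topologicalClosure ⟨v, rfl⟩)
  refine ⟨K.starProjection, ?_, isStarProjection_starProjection, ?_, ?_, ?_⟩
  · rw [IsStarProjection.mem_iff isStarProjection_starProjection]
    intro y hy
    have hyf : Commute f y := hcommf y (mem_commutant_iff.1 hy Y hYN)
    rw [Module.End.mem_invtSubmodule, Submodule.range_starProjection]
    intro v hv
    have : Set.MapsTo y (f.range : Set H) (f.range : Set H) := by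
      rintro _ ⟨w, rfl⟩
      exact ⟨y w, congrArg (fun T => T w) hyf.eq⟩
    exact this.closure y.continuous hv
  · have := hle (1 - p) (by rw [sub_mul, one_mul, hpf, sub_self])
    rwa [sub_mul, one_mul, sub_eq_zero, eq_comm] at this
  · intro h
    rw [h, zero_mul] at hqf
    exact hf0 hqf.symm
  · intro h
    have := hle g hgf
    rw [h, hgp] at this
    exact hg0 this

end VonNeumannAlgebra

namespace Hyperfinite

/-! ### Series of the operators `refl n` -/

/-- The operator `∑ₙ cₙ Rₙ`. -/
noncomputable def series (c : ℕ → ℝ) : L2 →L[ℂ] L2 := ∑' n, (c n : ℂ) • refl n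

lemma norm_smul_refl_le (a : ℝ) (n : ℕ) : ‖(a : ℂ) • refl n‖ ≤ |a| := by
  rw [norm_smul, Complex.norm_real, Real.norm_eq_abs]
  exact mul_le_of_le_one_right (abs_nonneg _) (norm_refl_le n)

lemma summable_smul_refl {c : ℕ → ℝ} (hc : Summable c) :
    Summable fun n => (c n : ℂ) • refl n :=
  Summable.of_norm_bounded hc.abs fun n => norm_smul_refl_le _ n

lemma norm_series_le {c : ℕ → ℝ} (hc : Summable c) : ‖series c‖ ≤ ∑' n, |c n| :=
  tsum_of_norm_bounded hc.abs.hasSum fun n => norm_smul_refl_le _ n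

lemma commute_series {c : ℕ → ℝ} {T : L2 →L[ℂ] L2}
    (h : ∀ n, c n ≠ 0 → Commute T (refl n)) : Commute T (series c) := by
  refine Commute.tsum_right T fun n => ?_
  by_cases hn : c n = 0
  · simp [hn]
  · exact (h n hn).smul_right _

lemma isSelfAdjoint_series (c : ℕ → ℝ) : IsSelfAdjoint (series c) := by
  rw [IsSelfAdjoint, series, tsum_star]
  refine tsum_congr fun n => ?_
  rw [star_smul, (isSelfAdjoint_refl n).star_eq]
  simp

lemma summable_off {c : ℕ → ℝ} (hc : Summable c) (E : Finset ℕ) :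
    Summable fun n => if n ∈ E then 0 else c n := by
  refine Summable.of_norm_bounded hc.abs fun n => ?_
  split_ifs <;> simp

lemma series_eq_sum_add {c : ℕ → ℝ} (hc : Summable c) (E : Finset ℕ) :
    series c = ∑ n ∈ E, (c n : ℂ) • refl n + series fun n => if n ∈ E then 0 else c n := by
  have h1 : HasSum (fun n => if n ∈ E then (c n : ℂ) • refl n else 0)
      (∑ n ∈ E, (c n : ℂ) • refl n) := by
    rw [← Finset.sum_congr rfl fun n (hn : n ∈ E) => if_pos hn]
    exact hasSum_sum_of_ne_finset_zero fun n hn => if_neg hn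
  refine (tsum_congr fun n => ?_).trans
    (h1.add (summable_smul_refl (summable_off hc E)).hasSum).tsum_eq
  by_cases hn : n ∈ E <;> simp [hn]

/-- Conjugation by `flip n` changes the sign of the `n`-th term of the series. -/
lemma flip_mul_series {c : ℕ → ℝ} (hc : Summable c) (n : ℕ) :
    flip n * series c = (series c - (2 * c n : ℂ) • refl n) * flip n := by
  have h : Commute (flip n) (series fun m => if m ∈ ({n} : Finset ℕ) then 0 else c m) :=
    commute_series fun m hm => commute_flip_refl fun hnm => hm (by simp [hnm])
  rw [series_eq_sum_add hc {n}, Finset.sum_singleton, mul_add, h.eq, mul_smul_comm, flip_mul_refl,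
    sub_mul, add_mul, smul_mul_assoc, smul_mul_assoc]
  module

/-! ### Absence of eigenvectors -/

lemma norm_isoOp_apply_le (φ : ElemTensor → ElemTensor)
    (hφ : ∀ x y, traceForm (φ x) (φ y) = traceForm x y) (ξ : L2) : ‖isoOp φ hφ ξ‖ ≤ ‖ξ‖ := by
  induction ξ using UniformSpace.Completion.induction_on with
  | hp => exact isClosed_le (by fun_prop) (by fun_prop)
  | ih a =>
    rw [isoOp, ContinuousLinearMap.completion_apply_coe, UniformSpace.Completion.norm_coe,
      UniformSpace.Completion.norm_coe, ← one_mul ‖a‖]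
    exact ContinuousLinearMap.le_of_opNorm_le _ (LinearMap.mkContinuous_norm_le _ zero_le_one _) _

lemma flipM_mul_star_flipM : flipM * star flipM = 1 := by rw [star_flipM, flipM_mul_self]

/-- Conjugation `x ↦ D x D` at site `n`, where `D` is `flipM`. -/
noncomputable def conjFlip (n : ℕ) : L2 →L[ℂ] L2 :=
  flip n * rightSite n flipM flipM_mul_star_flipM

lemma norm_conjFlip_apply_le (n : ℕ) (ξ : L2) : ‖conjFlip n ξ‖ ≤ ‖ξ‖ := by
  have h1 : ‖flip n‖ ≤ 1 := by
    have h := CStarRing.norm_star_mul_self (x := flip n)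
    rw [(isSelfAdjoint_flip n).star_eq, flip_mul_self] at h
    have h1 : ‖(1 : L2 →L[ℂ] L2)‖ ≤ 1 := ContinuousLinearMap.norm_id_le
    nlinarith [norm_nonneg (flip n)]
  refine ((flip n).le_of_opNorm_le h1 _).trans ?_
  rw [one_mul]
  exact norm_isoOp_apply_le _ _ ξ

/-- Conjugation at a site where the factor is `1` does nothing. -/
lemma eventually_conjFlip_eq_self {ζ : L2} (hζ : ζ ∈ Submodule.span ℂ (Set.range elem)) :
    ∀ᶠ n in Filter.atTop, conjFlip n ζ = ζ := by
  induction hζ using Submodule.span_induction with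
  | mem _ h =>
    obtain ⟨x, rfl⟩ := h
    have : ∀ᶠ n in Filter.atTop, n ∉ {n | x.factor n ≠ 1} := by
      rw [← Nat.cofinite_eq_atTop]
      exact x.finite_ne_one.eventually_cofinite_notMem
    filter_upwards [this] with n hn
    have hn1 : x.factor n = 1 := by simpa using hn
    rw [conjFlip, mul_apply_eq_comp, rightSite_elem, flip, site_elem]
    congr 1
    ext m : 2
    simp only [ElemTensor.siteMul, ElemTensor.mulSite, Function.update_self, Function.update_idem,
      hn1, one_mul, flipM_mul_self]
    rw [← hn1, Function.update_eq_self]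
  | zero => exact Filter.Eventually.of_forall fun n => map_zero _
  | add a b _ _ ha hb =>
    filter_upwards [ha, hb] with n h1 h2
    rw [map_add, h1, h2]
  | smul c a _ ha =>
    filter_upwards [ha] with n h1
    rw [map_smul, h1]

/-- `∑ₙ cₙ Rₙ` has no eigenvectors if infinitely many `cₙ` are nonzero. Conjugation by `D` at site
`n` moves the eigenspace of `t` into the sum of the eigenspaces of `t ± 2 cₙ`, so it maps every
eigenvector `ξ` to a vector orthogonal to `ξ`; but for large `n` it moves `ξ` arbitrarily little. -/
lemma eq_zero_of_series_apply_eq_smul {c : ℕ → ℝ} (hc : Summable c)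
    (hc0 : ∃ᶠ n in Filter.atTop, c n ≠ 0) {t : ℝ} {ξ : L2} (hξ : series c ξ = (t : ℂ) • ξ) :
    ξ = 0 := by
  set X := series c with hX
  have hXs : ContinuousLinearMap.adjoint X = X := isSelfAdjoint_series c
  have horth : ∀ n, c n ≠ 0 → inner ℂ ξ (conjFlip n ξ) = 0 := by
    intro n hn
    set C := conjFlip n with hC
    set r := refl n with hr
    have hrs : ContinuousLinearMap.adjoint r = r := isSelfAdjoint_refl n
    have hrX : Commute r X := commute_series fun m _ => commute_refl n m
    have hρr := commute_site_rightSite n n reflM flipM flipM_mul_star_flipM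
    have hρX : Commute (rightSite n flipM flipM_mul_star_flipM) X :=
      commute_series fun m _ => (commute_site_rightSite m n reflM flipM _).symm
    have hCX : C * X = X * C - (2 * c n : ℂ) • (r * C) := by
      rw [hC, conjFlip, mul_assoc, hρX.eq, ← mul_assoc, flip_mul_series hc, sub_mul, sub_mul,
        smul_mul_assoc, smul_mul_assoc, mul_assoc, mul_assoc]
    set η := r ξ with hη
    have hη1 : X η = (t : ℂ) • η := by
      have := congrArg (fun T => T ξ) hrX.eq
      simp only [mul_apply_eq_comp] at this
      rw [hη, ← this, hξ, map_smul]
    have hrη : r η = ξ := congrArg (fun T => T ξ) (refl_mul_self n)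
    have h := congrArg (fun T : L2 →L[ℂ] L2 => inner ℂ η (T ξ)) hCX
    simp only [mul_apply_eq_comp, sub_apply, smul_apply, inner_sub_right,
      inner_smul_right] at h
    rw [← ContinuousLinearMap.adjoint_inner_left X, hXs, ← ContinuousLinearMap.adjoint_inner_left r,
      hrs, hrη, hη1, hξ, map_smul, inner_smul_left, inner_smul_right, Complex.conj_ofReal,
      eq_comm, sub_eq_self, mul_eq_zero] at h
    exact h.resolve_left (by simpa using hn)
  by_contra hne
  have hpos : 0 < ‖ξ‖ := norm_pos_iff.2 hne
  obtain ⟨ζ, hζ, hd⟩ := Metric.mem_closure_iff.1 (dense_span_elem ξ) (‖ξ‖ / 2) (by positivity)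
  obtain ⟨n, hn, hfix⟩ := (hc0.and_eventually (eventually_conjFlip_eq_self hζ)).exists
  rw [dist_eq_norm] at hd
  have h1 : ‖ξ - conjFlip n ξ‖ < ‖ξ‖ := by
    have : ξ - conjFlip n ξ = (ξ - ζ) - conjFlip n (ξ - ζ) := by rw [map_sub, hfix]; abel
    rw [this]
    linarith [norm_sub_le (ξ - ζ) (conjFlip n (ξ - ζ)), norm_conjFlip_apply_le n (ξ - ζ)]
  have h2 : ‖ξ‖ ^ 2 ≤ ‖ξ‖ * ‖ξ - conjFlip n ξ‖ := by
    have := norm_inner_le_norm (𝕜 := ℂ) ξ (ξ - conjFlip n ξ)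
    rwa [inner_sub_right, horth n hn, sub_zero, inner_self_eq_norm_sq_to_K, norm_pow,
      RCLike.norm_ofReal, abs_norm] at this
  nlinarith

/-! ### Recovering `refl m` from the series -/

/-- If the `m`-th coefficient of `X = ∑ₙ cₙ Rₙ` dominates the sum of the others, then
`X Rₘ = |X|`. Since `X` is injective, everything that commutes with `X` commutes with `Rₘ`. -/
lemma commute_refl_of_commute_series {c : ℕ → ℝ} (hc : Summable c)
    (hc0 : ∃ᶠ n in Filter.atTop, c n ≠ 0) (m : ℕ)
    (hdom : ∑' n, |if n ∈ ({m} : Finset ℕ) then 0 else c n| ≤ c m) {y : L2 →L[ℂ] L2}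
    (hy : Commute (series c) y) : Commute (refl m) y := by
  set X := series c with hX
  set r := refl m with hr
  have hrX : Commute r X := commute_series fun n _ => commute_refl m n
  set S := series fun n => if n ∈ ({m} : Finset ℕ) then 0 else c n with hS
  have hrS : Commute r S := commute_series fun n _ => commute_refl m n
  have hXr : X * r = algebraMap ℝ _ (c m) + S * r := by
    rw [hX, series_eq_sum_add hc {m}, Finset.sum_singleton, add_mul, smul_mul_assoc,
      refl_mul_self, Algebra.algebraMap_eq_smul_one]
    rfl
  have hnorm : ‖S * r‖ ≤ c m := by
    refine (norm_mul_le _ _).trans ?_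
    refine (mul_le_of_le_one_right (norm_nonneg _) (norm_refl_le m)).trans ?_
    exact (norm_series_le (summable_off hc _)).trans hdom
  have hsa : IsSelfAdjoint (S * r) := by
    rw [IsSelfAdjoint, star_mul, (isSelfAdjoint_refl m).star_eq, (isSelfAdjoint_series _).star_eq,
      hrS.eq]
  have hnonneg : 0 ≤ X * r := by
    have h1 := hsa.neg_algebraMap_norm_le_self
    have h2 : algebraMap ℝ (L2 →L[ℂ] L2) ‖S * r‖ ≤ algebraMap ℝ _ (c m) :=
      algebraMap_mono _ hnorm
    rw [hXr]
    exact (neg_le_iff_add_nonneg'.1 h1).trans (add_le_add_left h2 _)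
  have hsqrt : CFC.sqrt (X * X) = X * r := by
    refine CFC.sqrt_unique ?_ hnonneg
    rw [mul_assoc, ← mul_assoc r X, hrX.eq, mul_assoc, refl_mul_self, mul_one]
  have hcomm : Commute (X * r) y := by
    rw [← hsqrt]
    exact (hy.mul_left hy).cfcₙ_nnreal _
  ext v
  rw [← sub_eq_zero]
  refine eq_zero_of_series_apply_eq_smul hc hc0 (t := 0) ?_
  have h : X * (r * y) = X * (y * r) := by
    rw [← mul_assoc, hcomm.eq, ← mul_assoc, ← mul_assoc, hy.eq]
  have hv := congrArg (fun T => T v) h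
  rw [map_sub, Complex.ofReal_zero, zero_smul, sub_eq_zero]
  exact hv

/-! ### The series `X α` -/

lemma Rop_eq (n : ℕ+) : Rop n = refl ((n : ℕ) - 1) := rfl

lemma Rop_succPNat (n : ℕ) : Rop n.succPNat = refl n := by
  rw [Rop_eq]; simp

lemma range_Rop : Set.range Rop = Set.range refl := by
  ext T
  constructor
  · rintro ⟨n, rfl⟩; exact ⟨_, rfl⟩
  · rintro ⟨n, rfl⟩; exact ⟨_, Rop_succPNat n⟩

lemma summable_pow_succ {α : ℝ} (h0 : 0 < α) (h1 : α < 1) :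
    Summable fun n : ℕ => α ^ (n + 1) :=
  (summable_nat_add_iff 1).2 (summable_geometric_of_lt_one h0.le h1)

lemma summable_smul_Rop {α : ℝ} (h0 : 0 < α) (h1 : α < 1) :
    Summable fun n : ℕ+ => ((α : ℂ) ^ (n : ℕ)) • Rop n := by
  rw [← Equiv.pnatEquivNat.symm.summable_iff]
  refine (summable_smul_refl (summable_pow_succ h0 h1)).congr fun n => ?_
  simp [Rop_succPNat]

lemma X_eq_series (α : ℝ) : X α = series fun n => α ^ (n + 1) := by
  rw [X, series, ← Equiv.pnatEquivNat.symm.tsum_eq]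
  refine tsum_congr fun n => ?_
  simp [Rop_succPNat]

lemma isSelfAdjoint_X (α : ℝ) : IsSelfAdjoint (X α) := by
  rw [X_eq_series]; exact isSelfAdjoint_series _

lemma mem_WX {α : ℝ} {T : L2 →L[ℂ] L2} :
    T ∈ WX α ↔ ∀ y, Commute (X α) y → Commute y T := by
  rw [WX, VonNeumannAlgebra.mem_generatedBy_of_isSelfAdjoint] <;> simp [isSelfAdjoint_X]

lemma mem_cartanMasa {T : L2 →L[ℂ] L2} :
    T ∈ cartanMasa ↔ ∀ y, (∀ n, Commute (refl n) y) → Commute y T := by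
  rw [cartanMasa, range_Rop, VonNeumannAlgebra.mem_generatedBy_of_isSelfAdjoint] <;>
    simp [isSelfAdjoint_refl]

lemma refl_mem_cartanMasa (n : ℕ) : refl n ∈ cartanMasa :=
  mem_cartanMasa.2 fun _ h => (h n).symm

lemma isAbelian_cartanMasa : cartanMasa.IsAbelian := by
  rw [cartanMasa, range_Rop]
  refine VonNeumannAlgebra.isAbelian_generatedBy ?_ ?_
  · rintro _ ⟨n, rfl⟩; exact isSelfAdjoint_refl n
  · rintro _ ⟨n, rfl⟩ _ ⟨m, rfl⟩; exact commute_refl n m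

lemma X_mem_WX (α : ℝ) : X α ∈ WX α := mem_WX.2 fun _ h => h.symm

lemma WX_le_cartanMasa (α : ℝ) : WX α ≤ cartanMasa := by
  refine VonNeumannAlgebra.generatedBy_le ?_
  rintro _ rfl
  refine mem_cartanMasa.2 fun y hy => ?_
  rw [X_eq_series]
  exact commute_series fun n _ => (hy n).symm

lemma isAbelian_WX (α : ℝ) : (WX α).IsAbelian := fun a ha b hb =>
  isAbelian_cartanMasa a (WX_le_cartanMasa α ha) b (WX_le_cartanMasa α hb)

lemma isDiffuse_WX {α : ℝ} (h0 : 0 < α) (h1 : α < 1) : (WX α).IsDiffuse := by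
  refine VonNeumannAlgebra.isDiffuse_of_forall_eigenvector_eq_zero (isAbelian_WX α) (X_mem_WX α)
    (isSelfAdjoint_X α) fun t ξ hξ => ?_
  rw [X_eq_series] at hξ
  exact eq_zero_of_series_apply_eq_smul (summable_pow_succ h0 h1)
    (Filter.Frequently.of_forall fun n => by positivity) hξ

/-! ### The case `α ≤ 1 / 2` -/

/-- The dominance `∑_{n > m} αⁿ⁺¹ ≤ αᵐ⁺¹`, which is equivalent to `α ≤ 1 / 2`. -/
lemma tsum_tail_le {α : ℝ} (h0 : 0 < α) (h1 : α ≤ 1 / 2) (m : ℕ) :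
    ∑' n : ℕ, (if n ∈ Finset.range (m + 1) then 0 else α ^ (n + 1)) ≤ α ^ (m + 1) := by
  have hα : α < 1 := by linarith
  have hs := summable_pow_succ h0 hα
  have hs' := summable_off hs (Finset.range (m + 1))
  rw [← hs'.sum_add_tsum_nat_add (m + 1), Finset.sum_eq_zero fun n hn => if_pos hn, zero_add]
  have : ∀ n : ℕ, (if n + (m + 1) ∈ Finset.range (m + 1) then 0 else α ^ (n + (m + 1) + 1)) =
      α ^ n * α ^ (m + 2) := by
    intro n
    rw [if_neg (Finset.mem_range.not.2 (by omega)), ← pow_add]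
    rfl
  simp only [this]
  rw [tsum_mul_right, tsum_geometric_of_lt_one h0.le hα, inv_mul_le_iff₀ (by linarith), pow_succ _ (m + 1)]
  nlinarith [pow_pos h0 (m + 1)]

lemma WX_eq_cartanMasa {α : ℝ} (h0 : 0 < α) (h1 : α ≤ 1 / 2) : WX α = cartanMasa := by
  refine le_antisymm (WX_le_cartanMasa α) ?_
  rw [cartanMasa, range_Rop]
  refine VonNeumannAlgebra.generatedBy_le ?_
  rintro _ ⟨m, rfl⟩
  refine mem_WX.2 fun y hy => Commute.symm ?_
  have hs := summable_pow_succ h0 (by linarith)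
  induction m using Nat.strong_induction_on with
  | _ m ih =>
    have hs' := summable_off hs (Finset.range m)
    refine commute_refl_of_commute_series hs' ?_ m ?_ ?_
    · refine Filter.Eventually.frequently ?_
      filter_upwards [Filter.eventually_ge_atTop m] with n hn
      rw [if_neg (by simpa using hn)]
      positivity
    · rw [if_neg (by simp)]
      refine le_of_eq_of_le (tsum_congr fun n => ?_) (tsum_tail_le h0 h1 m)
      have hp : 0 < α ^ (n + 1) := by positivity
      rcases lt_trichotomy n m with h | rfl | h
      · simp [h, h.ne, Nat.lt_succ_of_lt h]
      · simp
      · have h2 : ¬ n < m + 1 := by omega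
        simp [h.ne', not_lt.2 h.le, h2, abs_of_pos hp]
    · have := series_eq_sum_add hs (Finset.range m)
      rw [← X_eq_series, eq_comm, ← eq_sub_iff_add_eq'] at this
      rw [this]
      refine hy.sub_left (Commute.sum_left _ _ _ fun n hn => ?_)
      exact (ih n (Finset.mem_range.1 hn)).smul_left _

/-! ### Roots of signed polynomials -/

/-- For signs `sₙ`, `n ∈ E`, there are an operator `Q ≠ 0` with `Rₙ Q = sₙ Q` and an invertible
operator `D` that changes the signs of the `Rₙ`, `n ∈ E`, under conjugation: `Q` is the product of
the `1 + sₙ Rₙ` and `D` is the product of the `flip n`. The statements about `flip n` are there for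
the induction on `E`. -/
lemma exists_joint_eigenoperator (s : ℕ → ℤ) (E : Finset ℕ) (hs : ∀ n ∈ E, s n = 1 ∨ s n = -1) :
    ∃ Q D : L2 →L[ℂ] L2, Q ≠ 0 ∧ D * D = 1 ∧ (∀ n, Commute (refl n) Q) ∧
      (∀ n ∉ E, Commute (flip n) Q) ∧ (∀ n, Commute (flip n) D) ∧
      (∀ n ∈ E, refl n * Q = (s n : ℂ) • Q) ∧ (∀ n ∈ E, refl n * D = -(D * refl n)) ∧
      (∀ n ∉ E, Commute (refl n) D) := by
  induction E using Finset.induction_on with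
  | empty =>
    refine ⟨1, 1, ?_, by simp, ?_, ?_, ?_, by simp, by simp, ?_⟩
    · intro h
      have h1 := inner_elem ⟨fun _ => 1, by simp⟩ ⟨fun _ => 1, by simp⟩
      have h2 := congrArg (fun T : L2 →L[ℂ] L2 => T (elem ⟨fun _ => 1, by simp⟩)) h
      rw [show elem ⟨fun _ => 1, by simp⟩ = 0 from h2] at h1
      simp [traceForm, tr2_one] at h1
    all_goals simp
  | insert m E hm ih =>
    obtain ⟨Q, D, hQ, hD, h1, h2, h3, h4, h5, h6⟩ := ih fun n hn => hs n (Finset.mem_insert_of_mem hn)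
    have hsm : (s m : ℂ) * s m = 1 := by
      rcases hs m (Finset.mem_insert_self _ _) with h | h <;> simp [h]
    refine ⟨(1 + (s m : ℂ) • refl m) * Q, flip m * D, ?_, ?_, ?_, ?_, ?_, ?_, ?_, ?_⟩
    · intro h
      -- Conjugation by `flip m` gives `(1 - sₘ Rₘ) Q = 0` too.
      have h' : flip m * ((1 + (s m : ℂ) • refl m) * Q) =
          (1 - (s m : ℂ) • refl m) * Q * flip m := by
        rw [mul_assoc _ Q, ← (h2 m hm).eq, ← mul_assoc, ← mul_assoc, mul_add, sub_mul,
          mul_smul_comm, flip_mul_refl, smul_mul_assoc, smul_neg, ← sub_eq_add_neg]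
        simp
      rw [h, mul_zero] at h'
      have h'' := congrArg (· * flip m) h'
      simp only [zero_mul] at h''
      rw [mul_assoc, flip_mul_self, mul_one] at h''
      apply hQ
      have : (2 : ℂ) • Q = (1 + (s m : ℂ) • refl m) * Q + (1 - (s m : ℂ) • refl m) * Q := by
        rw [← add_mul, add_add_sub_cancel, ← two_smul ℂ, smul_mul_assoc, one_mul]
      rw [h, ← h'', add_zero] at this
      exact (smul_eq_zero.1 this).resolve_left two_ne_zero
    · rw [(h3 m).symm.mul_mul_mul_comm, flip_mul_self, hD, one_mul]
    · intro n
      exact ((Commute.one_right _).add_right ((commute_refl n m).smul_right _)).mul_right (h1 n)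
    · intro n hn
      rw [Finset.mem_insert, not_or] at hn
      exact ((Commute.one_right _).add_right
        ((commute_flip_refl hn.1).smul_right _)).mul_right (h2 n hn.2)
    · intro n
      refine Commute.mul_right ?_ (h3 n)
      rcases eq_or_ne n m with rfl | h
      · exact Commute.refl _
      · exact commute_site_of_ne h _ _
    · intro n hn
      rcases Finset.mem_insert.1 hn with rfl | hn
      · rw [← mul_assoc, mul_add, mul_smul_comm, refl_mul_self, mul_one, ← smul_mul_assoc,
          smul_add, smul_smul, hsm, one_smul, add_comm]
      · rw [← mul_assoc, ((Commute.one_right (refl n)).add_right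
          ((commute_refl n m).smul_right _)).eq, mul_assoc, h4 n hn, mul_smul_comm]
    · intro n hn
      rcases Finset.mem_insert.1 hn with rfl | hn
      · rw [mul_assoc, ← (h6 n hm).eq, ← mul_assoc, ← mul_assoc, flip_mul_refl, neg_mul, neg_neg]
      · have hnm : m ≠ n := fun h => hm (h ▸ hn)
        rw [← mul_assoc, ← (commute_flip_refl hnm).eq, mul_assoc, h5 n hn, mul_neg, mul_assoc]
    · intro n hn
      rw [Finset.mem_insert, not_or] at hn
      exact (commute_flip_refl (Ne.symm hn.1)).symm.mul_right (h6 n hn.2)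

/-- If `∑_{n ∈ E} sₙ αⁿ = 0` then the operator `D Q` of `exists_joint_eigenoperator` commutes with
`X α`, since `∑_{n ∈ E} αⁿ⁺¹ Rₙ` annihilates both `Q` and `D Q`. It anticommutes with `Rₙ` for
`n ∈ E`. -/
lemma WX_lt_cartanMasa {α : ℝ} (h0 : 0 < α) (h1 : α < 1) (hα : IsSignedPolynomialRoot α) :
    WX α < cartanMasa := by
  obtain ⟨p, hp, hs, hroot⟩ := hα
  obtain ⟨Q, D, hQ, hD, hrQ, -, -, hE, hrD, hrD'⟩ :=
    exists_joint_eigenoperator p.coeff p.support hs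
  obtain ⟨m, hm⟩ := Polynomial.support_nonempty.2 hp
  refine lt_of_le_of_ne (WX_le_cartanMasa α) fun heq => ?_
  have hDQ : D * Q ≠ 0 := by
    intro h
    apply hQ
    rw [← one_mul Q, ← hD, mul_assoc, h, mul_zero]
  have hrDQ : ∀ n ∈ p.support, refl n * (D * Q) = -((p.coeff n : ℂ) • (D * Q)) := by
    intro n hn
    rw [← mul_assoc, hrD n hn, neg_mul, mul_assoc, hE n hn, mul_smul_comm]
  have hDQr : ∀ n ∈ p.support, D * Q * refl n = (p.coeff n : ℂ) • (D * Q) := by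
    intro n hn
    rw [mul_assoc, ← (hrQ n).eq, hE n hn, mul_smul_comm]
  have hsum : ∑ n ∈ p.support, (α ^ (n + 1) : ℂ) * (p.coeff n : ℂ) = 0 := by
    have h : ∑ n ∈ p.support, (p.coeff n : ℝ) * α ^ n = 0 := by
      rw [← hroot, Polynomial.aeval_eq_sum_range' (lt_add_one _)]
      simp only [zsmul_eq_mul]
      refine Finset.sum_subset Polynomial.supp_subset_range_natDegree_succ fun n _ hn => ?_
      simp [Polynomial.notMem_support_iff.1 hn]
    have h2 : ∑ n ∈ p.support, α ^ (n + 1) * (p.coeff n : ℝ) = 0 := by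
      rw [← mul_zero α, ← h, Finset.mul_sum]
      refine Finset.sum_congr rfl fun n _ => by ring
    exact_mod_cast congrArg (Complex.ofReal) h2
  have hcomm : Commute (X α) (D * Q) := by
    rw [X_eq_series, series_eq_sum_add (summable_pow_succ h0 h1) p.support]
    refine Commute.add_left ?_ ?_
    · have e1 : (∑ n ∈ p.support, ((α ^ (n + 1) : ℝ) : ℂ) • refl n) * (D * Q) = 0 := by
        rw [Finset.sum_mul, Finset.sum_congr rfl fun n hn => by
          rw [smul_mul_assoc, hrDQ n hn, smul_neg, smul_smul], Finset.sum_neg_distrib,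
          ← Finset.sum_smul]
        push_cast
        rw [hsum, zero_smul, neg_zero]
      have e2 : D * Q * (∑ n ∈ p.support, ((α ^ (n + 1) : ℝ) : ℂ) • refl n) = 0 := by
        rw [Finset.mul_sum, Finset.sum_congr rfl fun n hn => by
          rw [mul_smul_comm, hDQr n hn, smul_smul], ← Finset.sum_smul]
        push_cast
        rw [hsum, zero_smul]
      exact e1.trans e2.symm
    · refine (commute_series fun n hn => ?_).symm
      have : n ∉ p.support := fun h => hn (if_pos h)
      exact ((hrD' n this).mul_right (hrQ n)).symm
  have hmem : refl m ∈ WX α := heq ▸ refl_mem_cartanMasa m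
  have hc := (mem_WX.1 hmem _ hcomm).eq
  rw [hDQr m hm, hrDQ m hm, eq_neg_iff_add_eq_zero, ← two_smul ℂ, smul_smul, smul_eq_zero] at hc
  refine hDQ (hc.resolve_left (mul_ne_zero two_ne_zero ?_))
  exact_mod_cast Polynomial.mem_support_iff.1 hm

lemma isSignedPolynomialRoot_golden : IsSignedPolynomialRoot ((√5 - 1) / 2) := by
  have hc : ∀ i, (Polynomial.X ^ 2 + Polynomial.X - 1 : Polynomial ℤ).coeff i =
      (if i = 2 then 1 else 0) + (if 1 = i then 1 else 0) - (if i = 0 then 1 else 0) := by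
    intro i
    simp [Polynomial.coeff_X_pow, Polynomial.coeff_X, Polynomial.coeff_one]
  refine ⟨Polynomial.X ^ 2 + Polynomial.X - 1, fun h => ?_, fun i hi => ?_, ?_⟩
  · have := hc 2
    rw [h] at this
    simp at this
  · rw [Polynomial.mem_support_iff, hc] at hi
    rw [hc]
    split_ifs at hi ⊢ <;> simp_all
  · have h5 : √5 ^ 2 = 5 := Real.sq_sqrt (by norm_num)
    simp
    nlinarith

open scoped symmDiff

/-! ### The Pauli basis -/

/-- The elementary tensor with factor `R^[n ∈ F] D^[n ∈ G]` at site `n`, where `R` is `reflM` and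
`D` is `flipM`. -/
noncomputable def pauli (i : Finset ℕ × Finset ℕ) : ElemTensor where
  factor n := (if n ∈ i.1 then reflM else 1) * (if n ∈ i.2 then flipM else 1)
  finite_ne_one := by
    refine (i.1 ∪ i.2).finite_toSet.subset fun n hn => ?_
    by_contra h
    simp only [Finset.coe_union, Set.mem_union, Finset.mem_coe, not_or] at h
    exact hn (by simp [h.1, h.2])

lemma siteMul_reflM_pauli (n : ℕ) (F G : Finset ℕ) :
    (pauli (F, G)).siteMul n reflM = pauli (F ∆ {n}, G) := by
  ext m : 2
  rcases eq_or_ne m n with rfl | h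
  · rw [factor_siteMul_self]
    by_cases hm : m ∈ F <;>
      simp only [pauli, hm, Finset.mem_symmDiff, Finset.mem_singleton, if_true, if_false,
        not_true, not_false_iff, and_true, and_false, or_false, or_true,
        ← mul_assoc, reflM_mul_self, one_mul]
  · rw [factor_siteMul_ne h]
    simp [pauli, Finset.mem_symmDiff, h]

lemma mulSite_flipM_pauli (n : ℕ) (F G : Finset ℕ) :
    (pauli (F, G)).mulSite n flipM = pauli (F, G ∆ {n}) := by
  ext m : 2
  rcases eq_or_ne m n with rfl | h
  · by_cases hm : m ∈ G <;>
      simp only [ElemTensor.mulSite, Function.update_self, pauli, hm, Finset.mem_symmDiff,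
        Finset.mem_singleton, if_true, if_false, not_true, not_false_iff, and_true, and_false,
        or_false, or_true, mul_assoc, flipM_mul_self, mul_one]
  · simp [ElemTensor.mulSite, pauli, Finset.mem_symmDiff, h]

lemma siteMul_flipM_pauli (n : ℕ) (F G : Finset ℕ) :
    (pauli (F, G)).siteMul n flipM =
      (pauli (F, G ∆ {n})).siteMul n (if n ∈ F then -1 else 1) := by
  ext m : 2
  rcases eq_or_ne m n with rfl | h
  · rw [factor_siteMul_self, factor_siteMul_self]
    have h1 : flipM * (reflM * flipM) = -reflM := by
      rw [← mul_assoc, flipM_mul_reflM, neg_mul, mul_assoc, flipM_mul_self, mul_one]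
    by_cases hF : m ∈ F <;> by_cases hG : m ∈ G <;>
      simp only [pauli, hF, hG, Finset.mem_symmDiff, Finset.mem_singleton, if_true, if_false,
        not_true, not_false_iff, and_true, and_false, or_false, or_true,
        h1, flipM_mul_reflM, flipM_mul_self, one_mul, mul_one, neg_mul]
  · rw [factor_siteMul_ne h, factor_siteMul_ne h]
    simp [pauli, Finset.mem_symmDiff, h]

lemma siteMul_mulSite_reflM_pauli (n : ℕ) (i : Finset ℕ × Finset ℕ) :
    ((pauli i).mulSite n reflM).siteMul n reflM =
      (pauli i).siteMul n (if n ∈ i.2 then -1 else 1) := by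
  ext m : 2
  rcases eq_or_ne m n with rfl | h
  · rw [factor_siteMul_self, factor_siteMul_self]
    have h1 : flipM * reflM = -(reflM * flipM) := flipM_mul_reflM
    by_cases hF : m ∈ i.1 <;> by_cases hG : m ∈ i.2 <;>
      simp only [ElemTensor.mulSite, Function.update_self, pauli, hF, hG, if_true, if_false,
        one_mul, mul_one, neg_mul, mul_assoc, reflM_mul_self, h1, mul_neg]
    all_goals simp only [← mul_assoc, reflM_mul_self, one_mul]
  · rw [factor_siteMul_ne h, factor_siteMul_ne h]
    simp [ElemTensor.mulSite, Function.update_of_ne h]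

lemma tr2_pauli (i j : Finset ℕ × Finset ℕ) (n : ℕ) :
    tr2 (star ((pauli i).factor n) * (pauli j).factor n) =
      if (n ∈ i.1 ↔ n ∈ j.1) ∧ (n ∈ i.2 ↔ n ∈ j.2) then 1 else 0 := by
  by_cases h1 : n ∈ i.1 <;> by_cases h2 : n ∈ i.2 <;> by_cases h3 : n ∈ j.1 <;>
    by_cases h4 : n ∈ j.2 <;>
    simp [pauli, h1, h2, h3, h4, tr2, Matrix.trace, Matrix.mul_apply, Matrix.star_apply,
      Fin.sum_univ_two] <;> norm_num

lemma orthonormal_pauli : Orthonormal ℂ fun i => elem (pauli i) := by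
  classical
  rw [orthonormal_iff_ite]
  intro i j
  rw [inner_elem]
  split_ifs with h
  · subst h
    exact finprod_eq_one_of_forall_eq_one fun n => by simp [tr2_pauli]
  · obtain ⟨n, hn⟩ : ∃ n, ¬ ((n ∈ i.1 ↔ n ∈ j.1) ∧ (n ∈ i.2 ↔ n ∈ j.2)) := by
      by_contra! hall
      exact h (Prod.ext (Finset.ext fun n => (hall n).1) (Finset.ext fun n => (hall n).2))
    rw [traceForm_eq_mul n, tr2_pauli, if_neg hn, zero_mul]

lemma site_ite_neg_one (n : ℕ) (p : Prop) [Decidable p] (ξ : L2) :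
    site n (if p then -1 else 1) ξ = (if p then -1 else 1 : ℂ) • ξ := by
  split_ifs
  · rw [site_neg, site_one, neg_one_smul]; rfl
  · rw [site_one, one_smul]; rfl

lemma refl_pauli (n : ℕ) (F G : Finset ℕ) :
    refl n (elem (pauli (F, G))) = elem (pauli (F ∆ {n}, G)) := by
  rw [refl, site_elem, siteMul_reflM_pauli]

lemma flip_pauli (n : ℕ) (F G : Finset ℕ) :
    flip n (elem (pauli (F, G))) =
      (if n ∈ F then -1 else 1 : ℂ) • elem (pauli (F, G ∆ {n})) := by
  rw [flip, site_elem, siteMul_flipM_pauli, ← site_elem, site_ite_neg_one]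

lemma site_mem_span_pauli (n : ℕ) (u : M2) {ξ : L2}
    (hξ : ξ ∈ Submodule.span ℂ (Set.range fun i => elem (pauli i))) :
    site n u ξ ∈ Submodule.span ℂ (Set.range fun i => elem (pauli i)) := by
  set V := Submodule.span ℂ (Set.range fun i => elem (pauli i)) with hV
  have hr : ∀ η ∈ V, refl n η ∈ V := by
    intro η hη
    refine (Submodule.span_le (p := V.comap (refl n : L2 →ₗ[ℂ] L2))).2 ?_ hη
    rintro _ ⟨⟨F, G⟩, rfl⟩
    change refl n (elem (pauli (F, G))) ∈ V
    rw [refl_pauli]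
    exact Submodule.subset_span ⟨_, rfl⟩
  have hf : ∀ η ∈ V, flip n η ∈ V := by
    intro η hη
    refine (Submodule.span_le (p := V.comap (flip n : L2 →ₗ[ℂ] L2))).2 ?_ hη
    rintro _ ⟨⟨F, G⟩, rfl⟩
    change flip n (elem (pauli (F, G))) ∈ V
    rw [flip_pauli]
    exact V.smul_mem _ (Submodule.subset_span ⟨_, rfl⟩)
  rw [site_eq]
  exact add_mem (add_mem (add_mem (V.smul_mem _ hξ) (V.smul_mem _ (hr _ hξ)))
    (V.smul_mem _ (hf _ hξ))) (V.smul_mem _ (hr _ (hf _ hξ)))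

lemma elem_mem_span_pauli (x : ElemTensor) :
    elem x ∈ Submodule.span ℂ (Set.range fun i => elem (pauli i)) := by
  suffices h : ∀ s : Finset ℕ, ∀ x : ElemTensor, {n | x.factor n ≠ 1} ⊆ s →
      elem x ∈ Submodule.span ℂ (Set.range fun i => elem (pauli i)) from
    h x.finite_ne_one.toFinset x (by simp)
  intro s
  induction s using Finset.induction_on with
  | empty =>
    intro x hx
    have h : pauli (∅, ∅) = x := by
      ext n : 2
      have : n ∉ {n | x.factor n ≠ 1} := fun h => by simpa using hx h
      simp only [Set.mem_ofPred_eq, not_not] at this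
      simp [pauli, this]
    exact Submodule.subset_span ⟨(∅, ∅), congrArg elem h⟩
  | insert m s _ ih =>
    intro x hx
    have hsub : {n | Function.update x.factor m 1 n ≠ 1} ⊆ (s : Set ℕ) := by
      intro n hn
      have hnm : n ≠ m := by rintro rfl; simp at hn
      have hn' : n ∈ {n | x.factor n ≠ 1} := by simpa [Function.update_of_ne hnm] using hn
      have := hx hn'
      rw [Finset.coe_insert] at this
      exact this.resolve_left hnm
    set x' : ElemTensor := ⟨Function.update x.factor m 1, s.finite_toSet.subset hsub⟩ with hx'
    have hxx' : x'.siteMul m (x.factor m) = x := ElemTensor.ext (by simp [ElemTensor.siteMul, hx'])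
    rw [← hxx', ← site_elem]
    exact site_mem_span_pauli m (x.factor m) (ih x' hsub)

/-- The Hilbert basis of `L2` that consists of the tensor products of Pauli matrices. -/
noncomputable def pauliBasis : HilbertBasis (Finset ℕ × Finset ℕ) ℂ L2 :=
  HilbertBasis.mk orthonormal_pauli <| by
    rw [← Submodule.dense_iff_topologicalClosure_eq_top.1 dense_span_elem]
    refine Submodule.topologicalClosure_mono (Submodule.span_le.2 ?_)
    rintro _ ⟨x, rfl⟩
    exact elem_mem_span_pauli x

lemma pauliBasis_apply (i : Finset ℕ × Finset ℕ) : pauliBasis i = elem (pauli i) := by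
  simp [pauliBasis]

/-- The matrix entries of an operator in the Pauli basis. -/
noncomputable def entry (T : L2 →L[ℂ] L2) (i j : Finset ℕ × Finset ℕ) : ℂ :=
  inner ℂ (elem (pauli i)) (T (elem (pauli j)))

lemma ext_entry {T S : L2 →L[ℂ] L2} (h : ∀ i j, entry T i j = entry S i j) : T = S := by
  have hd : Dense (Submodule.span ℂ (Set.range pauliBasis) : Set L2) :=
    Submodule.dense_iff_topologicalClosure_eq_top.2 pauliBasis.dense_span
  refine ContinuousLinearMap.ext_on hd ?_
  rintro _ ⟨j, rfl⟩
  refine pauliBasis.repr.injective (lp.ext (funext fun i => ?_))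
  rw [pauliBasis.repr_apply_apply, pauliBasis.repr_apply_apply, pauliBasis_apply, pauliBasis_apply]
  exact h i j

lemma entry_mul (T S : L2 →L[ℂ] L2) (i j : Finset ℕ × Finset ℕ) :
    entry (T * S) i j = ∑' k, entry T i k * entry S k j := by
  rw [entry, mul_apply_eq_comp, ← ContinuousLinearMap.adjoint_inner_left,
    ← pauliBasis.tsum_inner_mul_inner]
  refine tsum_congr fun k => ?_
  rw [pauliBasis_apply, ContinuousLinearMap.adjoint_inner_left]
  rfl

/-! ### The commutant of `𝓐` in the hyperfinite factor -/

lemma star_isoOp_mul_isoOp (φ : ElemTensor → ElemTensor)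
    (hφ : ∀ x y, traceForm (φ x) (φ y) = traceForm x y) :
    star (isoOp φ hφ) * isoOp φ hφ = 1 := by
  refine ext_inner_inner_elem fun x y => ?_
  rw [mul_apply_eq_comp, ContinuousLinearMap.star_eq_adjoint,
    ContinuousLinearMap.adjoint_inner_right, isoOp_elem, isoOp_elem, inner_elem, hφ]
  exact (inner_elem x y).symm

lemma inner_isometry_conj {U T : L2 →L[ℂ] L2} (hU : star U * U = 1) (h : Commute U T)
    (ξ η : L2) : inner ℂ (U ξ) (T (U η)) = inner ℂ ξ (T η) := by
  have h1 : T (U η) = U (T η) := (congrArg (fun S => S η) h.eq).symm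
  rw [h1, ← ContinuousLinearMap.adjoint_inner_right, ← ContinuousLinearMap.star_eq_adjoint]
  exact congrArg (fun S : L2 →L[ℂ] L2 => inner ℂ ξ (S (T η))) hU

lemma symmDiff_invariant {f : Finset ℕ → Finset ℕ → ℂ}
    (hf : ∀ n F G, f (F ∆ {n}) (G ∆ {n}) = f F G) (H F G : Finset ℕ) :
    f (F ∆ H) (G ∆ H) = f F G := by
  induction H using Finset.induction_on with
  | empty => rw [← Finset.bot_eq_empty, symmDiff_bot, symmDiff_bot]
  | insert n H hn ih =>
    have : insert n H = H ∆ {n} := by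
      ext m
      rcases eq_or_ne m n with rfl | h <;> simp_all [Finset.mem_symmDiff]
    rw [this, ← symmDiff_assoc, ← symmDiff_assoc, hf, ih]

lemma entry_symmDiff_fst {y : L2 →L[ℂ] L2} (hy : ∀ n, Commute (refl n) y)
    (F F' G G' H : Finset ℕ) :
    entry y (F ∆ H, G) (F' ∆ H, G') = entry y (F, G) (F', G') := by
  refine symmDiff_invariant (f := fun A B => entry y (A, G) (B, G')) (fun n A B => ?_) H F F'
  simp only [entry]
  rw [← refl_pauli, ← refl_pauli]
  exact inner_isometry_conj (by rw [(isSelfAdjoint_refl n).star_eq, refl_mul_self]) (hy n) _ _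

lemma entry_symmDiff_snd {T : L2 →L[ℂ] L2}
    (hT : ∀ n, Commute (rightSite n flipM flipM_mul_star_flipM) T) (F F' G G' H : Finset ℕ) :
    entry T (F, G ∆ H) (F', G' ∆ H) = entry T (F, G) (F', G') := by
  refine symmDiff_invariant (f := fun A B => entry T (F, A) (F', B)) (fun n A B => ?_) H G G'
  simp only [entry]
  rw [← mulSite_flipM_pauli, ← mulSite_flipM_pauli, ← rightSite_elem _ _ flipM_mul_star_flipM,
    ← rightSite_elem _ _ flipM_mul_star_flipM]
  exact inner_isometry_conj (star_isoOp_mul_isoOp _ _) (hT n) _ _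

lemma reflM_mul_star_reflM : reflM * star reflM = 1 := by rw [star_reflM, reflM_mul_self]

/-- An operator that commutes with the left and right multiplications by the `Rₙ` is
block diagonal. -/
lemma entry_eq_zero {T : L2 →L[ℂ] L2} (hr : ∀ n, Commute (refl n) T)
    (hρ : ∀ n, Commute (rightSite n reflM reflM_mul_star_reflM) T) {i j : Finset ℕ × Finset ℕ}
    (hij : i.2 ≠ j.2) : entry T i j = 0 := by
  obtain ⟨n, hn⟩ : ∃ n, ¬ (n ∈ i.2 ↔ n ∈ j.2) := by
    by_contra! h
    exact hij (Finset.ext h)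
  set U := refl n * rightSite n reflM reflM_mul_star_reflM with hU
  have hU1 : star U * U = 1 := by
    rw [hU, star_mul, mul_assoc, ← mul_assoc (star (refl n)), (isSelfAdjoint_refl n).star_eq,
      refl_mul_self, one_mul]
    exact star_isoOp_mul_isoOp _ _
  have hUp : ∀ k, U (elem (pauli k)) = (if n ∈ k.2 then -1 else 1 : ℂ) • elem (pauli k) := by
    intro k
    rw [hU, mul_apply_eq_comp, rightSite_elem, refl, site_elem, siteMul_mulSite_reflM_pauli,
      ← site_elem, site_ite_neg_one]
  have h := inner_isometry_conj hU1 ((hr n).mul_left (hρ n)) (elem (pauli i)) (elem (pauli j))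
  rw [hUp, hUp, map_smul, inner_smul_left, inner_smul_right] at h
  change _ * (_ * entry T i j) = entry T i j at h
  by_cases h1 : n ∈ i.2 <;> by_cases h2 : n ∈ j.2 <;> simp [h1, h2] at hn h <;>
    exact self_eq_neg.1 h.symm

/-- In the Pauli basis, an operator `T` of this kind is the convolution by a function of `F` and
does not act on `G`, and an operator `y` of the commutant of `𝓐` has blocks that are convolutions
by functions of `F`. Such operators commute: the substitution `k ↦ i ∆ k ∆ j` interchanges the sums
for the entries of `T y` and of `y T`. -/
lemma mem_cartanMasa_of_commute {T : L2 →L[ℂ] L2} (hr : ∀ n, Commute (refl n) T)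
    (hρ : ∀ n, Commute (rightSite n reflM reflM_mul_star_reflM) T)
    (hρ' : ∀ n, Commute (rightSite n flipM flipM_mul_star_flipM) T) : T ∈ cartanMasa := by
  refine mem_cartanMasa.2 fun y hy => ext_entry ?_
  rintro ⟨F, G⟩ ⟨F', G'⟩
  rw [entry_mul, entry_mul]
  have hinv : Function.Involutive fun k : Finset ℕ × Finset ℕ => (F ∆ k.1 ∆ F', G ∆ k.2 ∆ G') := by
    have key : ∀ A B K : Finset ℕ, A ∆ (A ∆ K ∆ B) ∆ B = K := by
      intro A B K
      rw [symmDiff_assoc A K B, symmDiff_symmDiff_cancel_left, symmDiff_symmDiff_cancel_right]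
    rintro ⟨H, K⟩
    simp only [key]
  rw [← (Equiv.ofBijective _ hinv.bijective).tsum_eq]
  refine tsum_congr ?_
  rintro ⟨H, K⟩
  simp only [Equiv.ofBijective_apply]
  by_cases hK : G = K
  · subst hK
    have e1 : entry y (F, G) (F ∆ H ∆ F', G ∆ G ∆ G') = entry y (H, G) (F', G') := by
      rw [symmDiff_self, bot_symmDiff, ← entry_symmDiff_fst hy F _ _ _ (F ∆ H)]
      rw [symmDiff_symmDiff_cancel_left, symmDiff_comm (F ∆ H) F',
        symmDiff_symmDiff_cancel_right]
    have e2 : entry T (F ∆ H ∆ F', G ∆ G ∆ G') (F', G') = entry T (F, G) (H, G) := by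
      rw [symmDiff_self, bot_symmDiff, ← entry_symmDiff_fst hr _ _ _ _ (H ∆ F'),
        ← entry_symmDiff_snd hρ' _ _ _ _ (G' ∆ G), symmDiff_assoc F H F',
        symmDiff_symmDiff_cancel_right, symmDiff_symmDiff_cancel_left, symmDiff_comm H F',
        symmDiff_symmDiff_cancel_left]
    rw [e1, e2, mul_comm]
  · have e1 : entry T (F, G) (H, K) = 0 := entry_eq_zero hr hρ hK
    have e2 : entry T (F ∆ H ∆ F', G ∆ K ∆ G') (F', G') = 0 := by
      refine entry_eq_zero hr hρ fun h => hK ?_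
      exact symmDiff_eq_bot.1 (symmDiff_eq_right.1 h)
    rw [e1, e2, mul_zero, zero_mul]

lemma site_mem_R (n : ℕ) (u : M2) : site n u ∈ R :=
  VonNeumannAlgebra.subset_generatedBy _ ⟨n, u, rfl⟩

lemma commute_rightSite_of_mem_R {T : L2 →L[ℂ] L2} (hT : T ∈ R) (n : ℕ) (v : M2)
    (hv : v * star v = 1) : Commute (rightSite n v hv) T := by
  refine VonNeumannAlgebra.mem_generatedBy.1 hT _ ?_
  rintro _ ⟨m, u, rfl⟩
  rw [star_site]
  exact ⟨commute_site_rightSite m n u v hv, commute_site_rightSite m n _ v hv⟩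

lemma isMasa_cartanMasa : cartanMasa.IsMasa R := by
  refine ⟨?_, isAbelian_cartanMasa, fun B hBR hB hAB => le_antisymm (fun T hT => ?_) hAB⟩
  · refine VonNeumannAlgebra.generatedBy_le ?_
    rintro _ ⟨n, rfl⟩
    exact site_mem_R _ _
  · exact mem_cartanMasa_of_commute (fun n => hB _ (hAB (refl_mem_cartanMasa n)) _ hT)
      (fun n => commute_rightSite_of_mem_R (hBR hT) n _ _)
      (fun n => commute_rightSite_of_mem_R (hBR hT) n _ _)

/-! ### The normalizer of `𝓐` -/

lemma mem_normalizer_cartanMasa {u : L2 →L[ℂ] L2} (hR : u ∈ R) (hs : IsSelfAdjoint u)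
    (hu : u * u = 1) (h : ∀ a ∈ cartanMasa, u * a * u ∈ cartanMasa) :
    u ∈ cartanMasa.normalizer R := by
  refine ⟨hR, ?_, ?_⟩
  · rw [Unitary.mem_iff, hs.star_eq, hu]
    simp
  · rw [hs.star_eq]
    ext a
    constructor
    · rintro ⟨b, hb, rfl⟩
      exact h b hb
    · intro ha
      refine ⟨u * a * u, h a ha, ?_⟩
      simp only [← mul_assoc, hu, one_mul]
      rw [mul_assoc, hu, mul_one]

lemma flip_mul_mul_flip_mem (n : ℕ) {a : L2 →L[ℂ] L2} (ha : a ∈ cartanMasa) :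
    flip n * a * flip n ∈ cartanMasa := by
  -- Conjugation by `flip n` preserves the commutant of the `refl m`, up to signs.
  have hconj : ∀ y, (∀ m, Commute (refl m) y) → ∀ m, Commute (refl m) (flip n * y * flip n) := by
    intro y hy m
    rcases eq_or_ne n m with rfl | h
    · have h1 : refl n * flip n = -(flip n * refl n) := by rw [flip_mul_refl, neg_neg]
      calc refl n * (flip n * y * flip n) = refl n * flip n * (y * flip n) := by
            simp only [mul_assoc]
        _ = -(flip n * (refl n * y) * flip n) := by rw [h1]; simp only [neg_mul, mul_assoc]
        _ = flip n * y * -(refl n * flip n) := by rw [(hy n).eq]; simp only [mul_neg, mul_assoc]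
        _ = flip n * y * flip n * refl n := by rw [← flip_mul_refl]; simp only [mul_assoc]
    · exact ((commute_flip_refl h).symm.mul_right (hy m)).mul_right (commute_flip_refl h).symm
  refine mem_cartanMasa.2 fun y hy => ?_
  have h := (mem_cartanMasa.1 ha _ (hconj y hy)).eq
  have h' := congrArg (fun T => flip n * T * flip n) h
  change y * (flip n * a * flip n) = flip n * a * flip n * y
  have hff : ∀ T, flip n * (flip n * T) = T := fun T => by
    rw [← mul_assoc, flip_mul_self, one_mul]
  simpa only [mul_assoc, hff, flip_mul_self, mul_one] using h'

lemma isCartanMasa_cartanMasa : cartanMasa.IsCartanMasa R := by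
  refine ⟨isMasa_cartanMasa, le_antisymm ?_ ?_⟩
  · exact VonNeumannAlgebra.generatedBy_le fun T hT => hT.1
  · refine VonNeumannAlgebra.generatedBy_le ?_
    rintro _ ⟨n, u, rfl⟩
    set N := VonNeumannAlgebra.generatedBy (cartanMasa.normalizer R)
    have hr : refl n ∈ N := by
      refine VonNeumannAlgebra.subset_generatedBy _ (mem_normalizer_cartanMasa (site_mem_R _ _)
        (isSelfAdjoint_refl n) (refl_mul_self n) fun a ha => ?_)
      exact mul_mem (mul_mem (refl_mem_cartanMasa n) ha) (refl_mem_cartanMasa n)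
    have hf : flip n ∈ N :=
      VonNeumannAlgebra.subset_generatedBy _ (mem_normalizer_cartanMasa (site_mem_R _ _)
        (isSelfAdjoint_flip n) (flip_mul_self n) fun a ha => flip_mul_mul_flip_mem n ha)
    have hsmul : ∀ (c : ℂ) (T : L2 →L[ℂ] L2), T ∈ N → c • T ∈ N := fun c T hT =>
      N.toStarSubalgebra.smul_mem (show T ∈ N.toStarSubalgebra from hT) c
    rw [site_eq]
    exact add_mem (add_mem (add_mem (hsmul _ _ (one_mem N)) (hsmul _ _ hr)) (hsmul _ _ hf))
      (hsmul _ _ (mul_mem hr hf))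

end Hyperfinite

theorem mainTheorem9 :
    (∀ α : ℝ, 0 < α → α < 1 →
      Summable (fun n : ℕ+ => ((α : ℂ) ^ (n : ℕ)) • Hyperfinite.Rop n) ∧
      (Hyperfinite.WX α).IsAbelian ∧ (Hyperfinite.WX α).IsDiffuse) ∧
    Hyperfinite.cartanMasa.IsCartanMasa Hyperfinite.R ∧
    (∀ α : ℝ, 0 < α → α ≤ 1 / 2 → Hyperfinite.WX α = Hyperfinite.cartanMasa) ∧
    (∀ α : ℝ, 0 < α → α < 1 → Hyperfinite.IsSignedPolynomialRoot α →
      Hyperfinite.WX α < Hyperfinite.cartanMasa) ∧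
    (0 < (√5 - 1) / 2 ∧ (√5 - 1) / 2 < 1 ∧
      Hyperfinite.IsSignedPolynomialRoot ((√5 - 1) / 2)) := by
  refine ⟨fun α h0 h1 => ⟨Hyperfinite.summable_smul_Rop h0 h1, Hyperfinite.isAbelian_WX α,
    Hyperfinite.isDiffuse_WX h0 h1⟩, Hyperfinite.isCartanMasa_cartanMasa,
    fun α h0 h1 => Hyperfinite.WX_eq_cartanMasa h0 h1,
    fun α h0 h1 hα => Hyperfinite.WX_lt_cartanMasa h0 h1 hα, ?_, ?_,
    Hyperfinite.isSignedPolynomialRoot_golden⟩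
  · have : 1 < √5 := Real.lt_sqrt_of_sq_lt (by norm_num)
    linarith
  · have : √5 < 3 := (Real.sqrt_lt' (by norm_num)).2 (by norm_num)
    linarith
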